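/- Let $\lambda>0$ and let $T$ be a Galton–Watson tree with Poisson($\lambda$) offspring distribution, regarded as a directed graph with an arc from each individual to each of its children. Consider the two-player game in which the players alternately move along arcs and a player who cannot move loses. A position is a $\mathcal P$-position if the second player has a winning strategy from it, an $\mathcal N$-position if the first player has one, and a draw if neither has one. The rank of a position $x$ is the least $n$ for which $\mathcal G_n(x)$ is finite ($\infty$ if there is none), where $\mathcal G_0(x)=0$ if $x$ is terminal and $\mathcal G_0(x)=\infty$ otherwise, and, for $n\ge1$ and with $m$ the least natural number not in $\{\mathcal G_{n-1}(y): y\text{ an option of }x\}$, $\mathcal G_n(x)=m$ if every option $y$ of $x$ satisfies $\mathcal G_{n-1}(y)\le m$ or has an option $z$ with $\mathcal G_{n-1}(z)=m$, and $\mathcal G_n(x)=\infty$ otherwise. Then: 1. $T$ is infinite with positive probability if and only if $\lambda>1$. 2. If $\lambda>e$, then the root is a draw with positive probability. 3. If $\lambda\le e$, then almost surely no position of $T$ is a draw. Let $P$ be the probability that the root is a $\mathcal P$-position. Condition on the event that the root is an $\mathcal N$-position, remove all $\mathcal P$-positions from $T$, and let $T^{(1)}$ be the connected component of the root in the remaining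 graph. Then (with the order of siblings inherited from $T$) $T^{(1)}$ is a Galton–Watson tree with Poisson($\lambda(1-P)$) offspring distribution, $\lambda(1-P)<\lambda$, and $T^{(1)}$ is again draw-free with probability $1$. Moreover, almost surely all positions of $T$ have finite rank. 4. Consequently there is no $\lambda>0$ for which almost surely there are no draws but with positive probability there is a position of infinite rank. -/

import Mathlib

open MeasureTheory ProbabilityTheory
open scoped NNReal ENNReal

noncomputable section

/-! ## Games on directed graphs (normal play) -/

namespace Digraph

variable {V : Type*} (G : Digraph V)

/-- `x` has no options. -/
def IsTerminal (x : V) : Prop := ∀ y, ¬ G.Adj x y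

/-- Histories of play from `x` in which one of the two players (the "strategist") uses the
strategy `σ`. A history is the list of positions visited so far, the current position first;
a strategy maps a history to the next position.
`G.Follows σ b₀ x b h`: the history `h` can occur when the game starts at `x`, and at its end the
strategist is to move iff `b = true`; the strategist makes the first move of the game iff
`b₀ = true`. -/
inductive Follows (σ : List V → V) (b₀ : Bool) (x : V) : Bool → List V → Prop
  | start : Follows σ b₀ x b₀ [x]
  | own {p : V} {h : List V} : Follows σ b₀ x true (p :: h) → G.Adj p (σ (p :: h)) →
      Follows σ b₀ x false (σ (p :: h) :: p :: h)
  | opponent {p q : V} {h : List V} : Follows σ b₀ x false (p :: h) → G.Adj p q →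
      Follows σ b₀ x true (q :: p :: h)

/-- `σ` is a winning strategy from `x`: whenever the strategist has to move, `σ` prescribes a legal
move (so that the strategist is never stuck), and no play goes on for ever. Hence every play ends
with the opponent unable to move. -/
def IsWinning (σ : List V → V) (b₀ : Bool) (x : V) : Prop :=
  (∀ p h, G.Follows σ b₀ x true (p :: h) → G.Adj p (σ (p :: h))) ∧
  ¬ ∃ f : ℕ → V, ∀ n, ∃ b, G.Follows σ b₀ x b ((List.range (n + 1)).map f).reverse

/-- `x` is an N-position: the player who moves first has a winning strategy. -/
def IsNPos (x : V) : Prop := ∃ σ, G.IsWinning σ true x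

/-- `x` is a P-position: the player who moves second has a winning strategy. -/
def IsPPos (x : V) : Prop := ∃ σ, G.IsWinning σ false x

/-- `x` is a draw (a D-position): neither player has a winning strategy. -/
def IsDPos (x : V) : Prop := ¬ G.IsNPos x ∧ ¬ G.IsPPos x

/-- No position is a draw. -/
def DrawFree : Prop := ∀ x, ¬ G.IsDPos x

/-- The least natural number that is not in `A`. -/
def mex (A : Set ℕ∞) : ℕ := sInf {m : ℕ | (m : ℕ∞) ∉ A}

open Classical in
/-- The approximations `𝒢ₙ` to the extended Sprague-Grundy function. -/
def grundy : ℕ → V → ℕ∞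
  | 0, x => if G.IsTerminal x then 0 else ⊤
  | n + 1, x =>
    let m : ℕ := mex {a | ∃ y, G.Adj x y ∧ grundy n y = a}
    if ∀ y, G.Adj x y → grundy n y ≤ m ∨ ∃ z, G.Adj y z ∧ grundy n z = m then m else ⊤

/-- The rank of `x`: the least `n` such that `𝒢ₙ(x)` is finite, and `⊤` if there is none. -/
def rank (x : V) : ℕ∞ := sInf {r : ℕ∞ | ∃ n : ℕ, r = n ∧ G.grundy n x ≠ ⊤}

end Digraph

/-! ## Galton-Watson trees

Individuals are words in `ℕ` (Ulam-Harris labels): the root is `[]`, and the `i`-th child of `u` is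
`u ++ [i]`, `i = 0, 1, …`. -/

namespace GW

/-- The tree in which each individual `v` has the `c v` children `v ++ [i]`, `i < c v`. -/
def tree (c : List ℕ → ℕ) : Set (List ℕ) :=
  {u | ∀ (v : List ℕ) (i : ℕ), v ++ [i] <+: u → i < c v}

/-- The law of the Galton-Watson tree with offspring distribution `p`: all family sizes are
independent with law `p`. The σ-algebra on sets of words is generated by the events `u ∈ T`. -/
def law (p : Measure ℕ) : Measure (Set (List ℕ)) :=
  (Measure.infinitePi (fun _ : List ℕ => p)).map tree

/-- The directed graph on a set `S` of individuals with an arc from each individual to each of its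
children. If `S` is a subset of a tree, this is the subgraph of the tree induced by `S`. -/
def graph (S : Set (List ℕ)) : Digraph S where
  Adj u v := ∃ i : ℕ, (v : List ℕ) = (u : List ℕ) ++ [i]

/-- The root is a P-position. -/
def RootP (T : Set (List ℕ)) : Prop := ∃ h : [] ∈ T, (graph T).IsPPos ⟨[], h⟩

/-- The root is an N-position. -/
def RootN (T : Set (List ℕ)) : Prop := ∃ h : [] ∈ T, (graph T).IsNPos ⟨[], h⟩

/-- The root is a draw. -/
def RootD (T : Set (List ℕ)) : Prop := ∃ h : [] ∈ T, (graph T).IsDPos ⟨[], h⟩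

/-- The vertices that remain when all P-positions are removed. -/
def removeP (T : Set (List ℕ)) : Set (List ℕ) :=
  {u | ∃ h : u ∈ T, ¬ (graph T).IsPPos ⟨u, h⟩}

/-- The connected component of the root in the graph on `S` (arcs may be used in both directions);
empty if the root is not in `S`. -/
def rootComponent (S : Set (List ℕ)) : Set (List ℕ) :=
  {u | ∃ (h₀ : [] ∈ S) (h : u ∈ S), Relation.EqvGen (graph S).Adj ⟨[], h₀⟩ ⟨u, h⟩}

/-- The new label of an individual when, in every family, the members that belong to `S` are
renumbered as `0, 1, 2, …` in the same order: each letter `i` is replaced by the number of older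
siblings that belong to `S`. -/
def relabel : Set (List ℕ) → List ℕ → List ℕ
  | _, [] => []
  | S, i :: w => Set.ncard {j : ℕ | j < i ∧ [j] ∈ S} :: relabel {w' | i :: w' ∈ S} w

/-- The reduced tree: remove all P-positions, keep the component of the root, and renumber the
remaining siblings in every family as `0, 1, 2, …` in the same order. -/
def reducedTree (T : Set (List ℕ)) : Set (List ℕ) :=
  relabel (rootComponent (removeP T)) '' rootComponent (removeP T)

end GW

end

/-! Remove the P-positions repeatedly: `stage k` holds the P-positions of the game left after `k`
removals, and `remaining (k + 1)` the vertices of `remaining k` with a child in `stage k`, so that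
draws are dropped. If every vertex lies in some stage, the index of its stage is a Sprague-Grundy
function whose reversible moves are undone in ever fewer rounds, and every rank is finite
(`rank_ne_top_of_forall_stage`).

For Poisson offspring the numbers of children in disjoint classes are independent. Hence having
children in all earlier stages is independent of having none in a later class
(`measureReal_remaining_inter_compl_hasChild`). With `r` and `x` the masses of `remaining k` and
`stage k`, and `λ` the parameter `lam`, this gives `x = r exp(-λ r exp(-λ x))`, so `x` and `r exp(-λ
x)` form a two-cycle of `t ↦ r exp(-λ t)`. For `λ r ≤ e` such a cycle is a fixed point
(`eq_of_two_cycle`); as `r ≤ 1`, the assumption `λ ≤ e` serves all stages at once. The equation `x =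
r exp(-λ x)` says that `stage k` and `remaining (k + 1)` exhaust `remaining k` up to a null set. A
vertex with finitely many children cannot survive every removal (`exists_notMem_remaining`), so
almost surely every vertex has a stage.

For `λ > e` the mass `P` of the P-positions is at most `1/λ`, and draws have mass `exp(-λ P) - P ≥
1/e - 1/λ > 0`.

The law of the reduced tree is Poisson thinning: the numbers of P-children and of other children are
independent, so the presence of a P-child, which makes the root an N-position, does not bias the
rest. Draw-freeness makes the kept children N-positions again, which closes a recursion on the
events that the tree contains a finite set `F`. -/

namespace Digraph

variable {V : Type*} (G : Digraph V)

/-! ### Winning strategies in locally finite graphs -/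

/-- The player who moves second can win from `x` within `n` rounds. -/
def PWithin : ℕ → V → Prop
  | 0, _ => False
  | n + 1, x => ∀ y, G.Adj x y → ∃ z, G.Adj y z ∧ PWithin n z

variable {G}

lemma PWithin.succ {n : ℕ} {x : V} (h : G.PWithin n x) : G.PWithin (n + 1) x := by
  induction n generalizing x with
  | zero => exact h.elim
  | succ n ih =>
    intro y hy
    obtain ⟨z, hz, hz'⟩ := h y hy
    exact ⟨z, hz, ih hz'⟩

lemma PWithin.mono {m n : ℕ} (hmn : m ≤ n) {x : V} (h : G.PWithin m x) : G.PWithin n x := by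
  induction hmn with
  | refl => exact h
  | step _ ih => exact ih.succ

/-- Local finiteness enters here: finitely many options have a common bound on the number of rounds,
so natural numbers suffice where ordinals would otherwise be needed. -/
lemma exists_pWithin_of_forall (hfin : ∀ x, {y | G.Adj x y}.Finite) {x : V}
    (h : ∀ y, G.Adj x y → ∃ z, G.Adj y z ∧ ∃ n, G.PWithin n z) : ∃ n, G.PWithin n x := by
  choose! z hz N hN using h
  obtain ⟨M, hM⟩ := ((hfin x).image N).bddAbove
  refine ⟨M + 1, fun y hy => ⟨z y, hz y hy, (hN y hy).mono (hM ⟨y, hy, rfl⟩)⟩⟩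

/-- The parity of the length of a history tells who is to move. -/
lemma Follows.even_length_iff {σ : List V → V} {b₀ b : Bool} {x : V} {h : List V}
    (H : G.Follows σ b₀ x b h) : Even h.length ↔ b = !b₀ := by
  induction H with
  | start => simp
  | own _ _ ih =>
    rw [List.length_cons, Nat.even_add_one, ih]
    cases b₀ <;> simp
  | opponent _ _ ih =>
    rw [List.length_cons, Nat.even_add_one, ih]
    cases b₀ <;> simp

lemma Follows.not_both {σ : List V → V} {b₀ : Bool} {x : V} {h : List V}
    (H : G.Follows σ b₀ x true h) (H' : G.Follows σ b₀ x false h) : False := by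
  have h1 := H.even_length_iff
  have h2 := H'.even_length_iff
  cases b₀ <;> simp_all

lemma Follows.cons_cons {σ : List V → V} {b₀ b : Bool} {x q p : V} {h : List V}
    (H : G.Follows σ b₀ x b (q :: p :: h)) :
    (b = false ∧ G.Follows σ b₀ x true (p :: h) ∧ q = σ (p :: h) ∧ G.Adj p q) ∨
    (b = true ∧ G.Follows σ b₀ x false (p :: h) ∧ G.Adj p q) := by
  generalize hl : q :: p :: h = l at H
  cases H with
  | start => simp at hl
  | own H1 H2 =>
    simp only [List.cons.injEq] at hl
    obtain ⟨rfl, rfl, rfl⟩ := hl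
    exact Or.inl ⟨rfl, H1, rfl, H2⟩
  | opponent H1 H2 =>
    simp only [List.cons.injEq] at hl
    obtain ⟨rfl, rfl, rfl⟩ := hl
    exact Or.inr ⟨rfl, H1, H2⟩

lemma reverse_map_range_succ {α : Type*} (f : ℕ → α) (n : ℕ) :
    ((List.range (n + 1)).map f).reverse = f n :: ((List.range n).map f).reverse := by
  simp [List.range_succ]

/-- The relation "`h'` extends the history `h` by one move" is well-founded below `[x]` when no
play that is consistent with `σ` goes on for ever. -/
lemma acc_of_no_infinite_play {σ : List V → V} {b₀ : Bool} {x : V}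
    (h : ¬ ∃ f : ℕ → V, ∀ n, ∃ b, G.Follows σ b₀ x b ((List.range (n + 1)).map f).reverse) :
    Acc (fun l' l : List V => (∃ b, G.Follows σ b₀ x b l') ∧ ∃ q, l' = q :: l) [x] := by
  by_contra hacc
  set r := fun l' l : List V => (∃ b, G.Follows σ b₀ x b l') ∧ ∃ q, l' = q :: l
  -- A history that is not accessible has an inaccessible extension; iterating the choice builds an
  -- infinite play.
  have step : ∀ l : {l : List V // ¬ Acc r l}, ∃ l' : {l : List V // ¬ Acc r l}, r l' l := by
    rintro ⟨l, hl⟩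
    by_contra! hcon
    refine hl ⟨_, fun l' hl' => ?_⟩
    by_contra h'
    exact hcon ⟨l', h'⟩ hl'
  choose g hg using step
  let s : ℕ → {l : List V // ¬ Acc r l} := fun n => Nat.rec ⟨[x], hacc⟩ (fun _ l => g l) n
  have hs : ∀ n, r (s (n + 1)).1 (s n).1 := fun n => hg (s n)
  -- No `s n` is empty, so the default value of `headD` is never used.
  refine h ⟨fun n => (s n).1.headD x, fun n => ?_⟩
  have key : ∀ n, ((List.range (n + 1)).map fun n => (s n).1.headD x).reverse = (s n).1 := by
    intro n
    induction n with
    | zero => simp [s]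
    | succ n ih =>
      obtain ⟨-, q, hq⟩ := hs n
      rw [reverse_map_range_succ, ih, hq]
      rfl
  rw [key]
  cases n with
  | zero => exact ⟨b₀, .start⟩
  | succ n => exact (hs n).1

/-- The induction runs over histories, since `σ` may treat two visits to the same position
differently. -/
lemma IsWinning.exists_pWithin (hfin : ∀ x, {y | G.Adj x y}.Finite) {σ : List V → V} {b₀ : Bool}
    {x : V} (hσ : G.IsWinning σ b₀ x) :
    (b₀ = false → ∃ n, G.PWithin n x) ∧
    (b₀ = true → ∃ y, G.Adj x y ∧ ∃ n, G.PWithin n y) := by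
  have main : ∀ l, Acc (fun l' l : List V => (∃ b, G.Follows σ b₀ x b l') ∧ ∃ q, l' = q :: l) l →
      ∀ p t, l = p :: t → (G.Follows σ b₀ x false l → ∃ n, G.PWithin n p) ∧
        (G.Follows σ b₀ x true l → ∃ y, G.Adj p y ∧ ∃ n, G.PWithin n y) := by
    intro l hl
    induction hl with
    | intro l _ ih =>
      rintro p t rfl
      refine ⟨fun hF => ?_, fun hF => ?_⟩
      · refine exists_pWithin_of_forall hfin fun y hy => ?_
        have hF' := Follows.opponent hF hy
        exact (ih _ ⟨⟨_, hF'⟩, _, rfl⟩ _ _ rfl).2 hF'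
      · have hadj := hσ.1 p t hF
        have hF' := Follows.own hF hadj
        exact ⟨_, hadj, (ih _ ⟨⟨_, hF'⟩, _, rfl⟩ _ _ rfl).1 hF'⟩
  have := main [x] (acc_of_no_infinite_play hσ.2) x [] rfl
  exact ⟨fun h => this.1 (h ▸ .start), fun h => this.2 (h ▸ .start)⟩

open Classical in
variable (G) in
/-- Move to an option from which the second player wins in as few rounds as possible. -/
noncomputable def quickStrategy [Nonempty V] (l : List V) : V :=
  match l with
  | [] => Classical.arbitrary V
  | p :: _ =>
    if h : ∃ n, ∃ y, G.Adj p y ∧ G.PWithin n y then (Nat.find_spec h).choose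
    else Classical.arbitrary V

/-- Minimality makes the number of rounds drop with each round; moving to an arbitrary P-position
could let the play go on for ever. -/
lemma quickStrategy_spec [Nonempty V] {n : ℕ} {p y : V} (hy : G.Adj p y) (hn : G.PWithin n y)
    (t : List V) : G.Adj p (G.quickStrategy (p :: t)) ∧ G.PWithin n (G.quickStrategy (p :: t)) := by
  classical
  have h : ∃ n, ∃ y, G.Adj p y ∧ G.PWithin n y := ⟨n, y, hy, hn⟩
  simp only [quickStrategy, dif_pos h]
  have := (Nat.find_spec h).choose_spec
  exact ⟨this.1, this.2.mono (Nat.find_min' h ⟨y, hy, hn⟩)⟩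

lemma isWinning_quickStrategy [Nonempty V] {b₀ : Bool} {x : V}
    (h0 : b₀ = false → ∃ n, G.PWithin n x)
    (h1 : b₀ = true → ∃ n, ∃ y, G.Adj x y ∧ G.PWithin n y) :
    G.IsWinning G.quickStrategy b₀ x := by
  have inv : ∀ b l, G.Follows G.quickStrategy b₀ x b l → ∀ p t, l = p :: t →
      (b = false → ∃ n, G.PWithin n p) ∧ (b = true → ∃ n, ∃ y, G.Adj p y ∧ G.PWithin n y) := by
    intro b l H
    induction H with
    | start =>
      rintro p t h
      obtain ⟨rfl, rfl⟩ := List.cons.inj h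
      exact ⟨h0, h1⟩
    | @own p l H hadj ih =>
      rintro q t h
      obtain ⟨rfl, rfl⟩ := List.cons.inj h
      obtain ⟨n, y, hy, hn⟩ := (ih p l rfl).2 rfl
      exact ⟨fun _ => ⟨n, (quickStrategy_spec hy hn l).2⟩, by simp⟩
    | @opponent p q l H hadj ih =>
      rintro q t h
      obtain ⟨rfl, rfl⟩ := List.cons.inj h
      obtain ⟨n, hn⟩ := (ih p l rfl).1 rfl
      refine ⟨by simp, fun _ => ?_⟩
      cases n with
      | zero => exact hn.elim
      | succ n => exact ⟨n, hn _ hadj⟩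
  refine ⟨fun p l H => ?_, ?_⟩
  · obtain ⟨n, y, hy, hn⟩ := (inv _ _ H p l rfl).2 rfl
    exact (quickStrategy_spec hy hn l).1
  · rintro ⟨f, hf⟩
    simp only [reverse_map_range_succ] at hf
    -- The opponent's move and the reply `f (m + 2)` lower the bound `n` by one, so an infinite play
    -- would descend below `0`.
    have key : ∀ n m, G.PWithin n (f m) →
        ¬ G.Follows G.quickStrategy b₀ x false (f m :: ((List.range m).map f).reverse) := by
      intro n
      induction n with
      | zero => exact fun m h => h.elim
      | succ n ih =>
        intro m hm H
        obtain ⟨b, hb⟩ := hf (m + 1)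
        obtain ⟨b', hb'⟩ := hf (m + 2)
        rw [reverse_map_range_succ] at hb hb'
        rcases hb.cons_cons with ⟨-, hb1, -⟩ | ⟨rfl, -, hadj⟩
        · exact hb1.not_both H
        obtain ⟨y, hy, hn⟩ := hm _ hadj
        rw [← reverse_map_range_succ f m] at hb
        rcases hb'.cons_cons with ⟨rfl, hb1, heq, -⟩ | ⟨-, hb1, -⟩
        · refine ih (m + 2) ?_ (by rw [reverse_map_range_succ]; exact hb')
          rw [heq]
          exact (quickStrategy_spec hy hn _).2
        · exact hb.not_both hb1
    obtain ⟨b, hb⟩ := hf 0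
    cases b with
    | false =>
      obtain ⟨n, hn⟩ := (inv _ _ hb _ _ rfl).1 rfl
      exact key n 0 hn hb
    | true =>
      obtain ⟨b', hb'⟩ := hf 1
      obtain ⟨n, y, hy, hn⟩ := (inv _ _ hb _ _ rfl).2 rfl
      rw [reverse_map_range_succ] at hb'
      rcases hb'.cons_cons with ⟨rfl, -⟩ | ⟨-, hb1, -⟩
      · obtain ⟨n, hn⟩ := (inv _ _ hb' _ _ rfl).1 rfl
        refine key n 1 hn (by rw [reverse_map_range_succ]; exact hb')
      · exact hb.not_both hb1

theorem isPPos_iff (hfin : ∀ x, {y | G.Adj x y}.Finite) (x : V) :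
    G.IsPPos x ↔ ∃ n, G.PWithin n x := by
  have : Nonempty V := ⟨x⟩
  exact ⟨fun ⟨σ, hσ⟩ => (hσ.exists_pWithin hfin).1 rfl,
    fun h => ⟨_, isWinning_quickStrategy (fun _ => h) (by simp)⟩⟩

theorem isNPos_iff (hfin : ∀ x, {y | G.Adj x y}.Finite) (x : V) :
    G.IsNPos x ↔ ∃ y, G.Adj x y ∧ ∃ n, G.PWithin n y := by
  have : Nonempty V := ⟨x⟩
  refine ⟨fun ⟨σ, hσ⟩ => (hσ.exists_pWithin hfin).2 rfl, fun ⟨y, hy, n, hn⟩ =>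
    ⟨_, isWinning_quickStrategy (by simp) (fun _ => ⟨n, y, hy, hn⟩)⟩⟩

/-! ### Positions of finite rank -/

lemma exists_natCast_notMem {A : Set ℕ∞} (hA : A.Finite) : {m : ℕ | (m : ℕ∞) ∉ A}.Nonempty := by
  have : (((↑) : ℕ → ℕ∞) ⁻¹' A).Finite := hA.preimage (Nat.cast_injective.injOn)
  exact this.infinite_compl.nonempty

lemma mex_notMem {A : Set ℕ∞} (hA : A.Finite) : ((mex A : ℕ) : ℕ∞) ∉ A :=
  Nat.sInf_mem (exists_natCast_notMem hA)

lemma mem_of_lt_mex {A : Set ℕ∞} {j : ℕ} (h : j < mex A) : (j : ℕ∞) ∈ A := by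
  by_contra hj
  exact Nat.notMem_of_lt_sInf h hj

lemma mex_eq {A : Set ℕ∞} {m : ℕ} (h : ∀ j < m, (j : ℕ∞) ∈ A) (hm : (m : ℕ∞) ∉ A) : mex A = m := by
  refine le_antisymm (Nat.sInf_le hm) (le_csInf ⟨m, hm⟩ fun j hj => ?_)
  by_contra! hlt
  exact hj (h j hlt)

lemma finite_grundy_options (hfin : ∀ x, {y | G.Adj x y}.Finite) (n : ℕ) (x : V) :
    {a | ∃ y, G.Adj x y ∧ G.grundy n y = a}.Finite :=
  (hfin x).image (G.grundy n)

/-- Every finite value of the approximations agrees with a given Sprague-Grundy function. -/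
lemma eq_of_grundy_eq (hfin : ∀ x, {y | G.Adj x y}.Finite) {g : V → ℕ}
    (hlt : ∀ x, ∀ j < g x, ∃ y, G.Adj x y ∧ g y = j) (hne : ∀ x y, G.Adj x y → g y ≠ g x)
    {n a : ℕ} {x : V} (h : G.grundy n x = a) : g x = a := by
  -- The hypotheses on `g` say that `g x` is the mex of the values of the options.
  have mexeq : ∀ (x : V) (m : ℕ), (∀ j < m, ∃ y, G.Adj x y ∧ g y = j) →
      (∀ y, G.Adj x y → g y ≠ m) → g x = m := by
    intro x m h1 h2
    rcases lt_trichotomy (g x) m with h | h | h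
    · obtain ⟨y, hy, hy'⟩ := h1 _ h
      exact absurd hy' (hne x y hy)
    · exact h
    · obtain ⟨y, hy, hy'⟩ := hlt x _ h
      exact absurd hy' (h2 y hy)
  induction n generalizing a x with
  | zero =>
    simp only [grundy] at h
    split_ifs at h with ht
    · have : a = 0 := by exact_mod_cast h.symm
      subst this
      exact mexeq x 0 (by simp) fun y hy => (ht y hy).elim
    · exact (ENat.top_ne_natCast a h).elim
  | succ n ih =>
    simp only [grundy] at h
    split_ifs at h with ht
    · have hmex := mex_notMem (finite_grundy_options hfin n x)
      have : mex {a | ∃ y, G.Adj x y ∧ G.grundy n y = a} = a := by exact_mod_cast h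
      rw [this] at ht hmex
      refine mexeq x a (fun j hj => ?_) fun y hy hya => ?_
      · obtain ⟨y, hy, hy'⟩ := mem_of_lt_mex (this ▸ hj)
        exact ⟨y, hy, ih hy'⟩
      · rcases ht y hy with hle | ⟨z, hz, hz'⟩
        -- The bound makes the approximation at `y` finite, hence equal to `g y = a`; but the mex is
        -- not a value of an option.
        · obtain ⟨b, hb⟩ := ENat.ne_top_iff_exists.1 (ne_top_of_le_ne_top (ENat.natCast_ne_top a) hle)
          have hba := ih hb.symm
          exact hmex ⟨y, hy, by rw [← hb, ← hba, hya]⟩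
        · exact hne y z hz ((ih hz').trans hya.symm)
    · exact (ENat.top_ne_natCast a h).elim

/-- A Sprague-Grundy function all of whose reversible moves can be reverted in a well-founded way
is the eventual value of the approximations. -/
lemma eventually_grundy_eq (hfin : ∀ x, {y | G.Adj x y}.Finite) {g d : V → ℕ}
    (hlt : ∀ x, ∀ j < g x, ∃ y, G.Adj x y ∧ g y = j) (hne : ∀ x y, G.Adj x y → g y ≠ g x)
    (hrev : ∀ x y, G.Adj x y → g x < g y → ∃ z, G.Adj y z ∧ g z = g x ∧ d z < d x) (x : V) :
    ∀ᶠ n in Filter.atTop, G.grundy n x = g x := by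
  -- Lexicographic induction: options of smaller value decrease `g`, and reverting moves keep `g`
  -- and decrease `d`.
  suffices H : ∀ p : ℕ ×ₗ ℕ, ∀ x, toLex (g x, d x) = p →
      ∀ᶠ n in Filter.atTop, G.grundy n x = g x from H _ x rfl
  intro p
  induction p using WellFoundedLT.induction with
  | ind p ih =>
  rintro x rfl
  have hop : ∀ᶠ n in Filter.atTop, ∀ y ∈ {y | G.Adj x y},
      (g y < g x → G.grundy n y = g y) ∧
      (g x < g y → ∃ z, G.Adj y z ∧ G.grundy n z = g x) := by
    rw [Filter.eventually_all_finite (hfin x)]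
    intro y hy
    rcases lt_or_gt_of_ne (hne x y hy) with h | h
    · filter_upwards [ih (toLex (g y, d y)) (Prod.Lex.toLex_lt_toLex.2 (Or.inl h)) y rfl] with n hn
      exact ⟨fun _ => hn, fun h' => absurd h' h.asymm⟩
    · obtain ⟨z, hz, hgz, hdz⟩ := hrev x y hy h
      filter_upwards [ih (toLex (g z, d z))
        (Prod.Lex.toLex_lt_toLex.2 (Or.inr ⟨hgz, hdz⟩)) z rfl] with n hn
      exact ⟨fun h' => absurd h' h.asymm, fun _ => ⟨z, hz, by rw [hn, hgz]⟩⟩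
  rw [← Filter.map_add_atTop_eq_nat 1, Filter.eventually_map]
  have hsmall : ∀ᶠ n in Filter.atTop, ∀ j < g x, ∃ y, G.Adj x y ∧ G.grundy n y = j := by
    filter_upwards [hop] with n hn j hj
    obtain ⟨y, hy, rfl⟩ := hlt x j hj
    exact ⟨y, hy, (hn y hy).1 hj⟩
  filter_upwards [hop, hsmall] with n hn hs
  -- Options of larger value may still be undetermined at time `n`; `eq_of_grundy_eq` prevents them
  -- from taking the value `g x`.
  have hmex : mex {a | ∃ y, G.Adj x y ∧ G.grundy n y = a} = g x :=
    mex_eq hs fun ⟨y, hy, hy'⟩ => hne x y hy (eq_of_grundy_eq hfin hlt hne hy')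
  rw [grundy]
  refine (if_pos fun y hy => ?_).trans (congrArg _ hmex)
  rw [hmex]
  rcases lt_or_gt_of_ne (hne x y hy) with h | h
  · exact Or.inl (by rw [(hn y hy).1 h]; exact_mod_cast h.le)
  · exact Or.inr ((hn y hy).2 h)

theorem rank_ne_top (hfin : ∀ x, {y | G.Adj x y}.Finite) {g d : V → ℕ}
    (hlt : ∀ x, ∀ j < g x, ∃ y, G.Adj x y ∧ g y = j) (hne : ∀ x y, G.Adj x y → g y ≠ g x)
    (hrev : ∀ x y, G.Adj x y → g x < g y → ∃ z, G.Adj y z ∧ g z = g x ∧ d z < d x) (x : V) :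
    G.rank x ≠ ⊤ := by
  obtain ⟨n, hn⟩ := (eventually_grundy_eq hfin hlt hne hrev x).exists
  exact ne_top_of_le_ne_top (ENat.natCast_ne_top n) (sInf_le ⟨n, rfl, by simp [hn]⟩)

end Digraph

namespace GW

/-! ### Family trees as functions of the family sizes -/

/-- The family sizes in the subtree of the `i`-th child of the root. -/
def child (c : List ℕ → ℕ) (i : ℕ) : List ℕ → ℕ := fun w => c (i :: w)

/-- The family sizes in the subtree of `u`. -/
def descend (c : List ℕ → ℕ) (u : List ℕ) : List ℕ → ℕ := fun w => c (u ++ w)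

@[simp] lemma descend_nil (c : List ℕ → ℕ) : descend c [] = c := rfl

lemma child_descend (c : List ℕ → ℕ) (u : List ℕ) (i : ℕ) :
    child (descend c u) i = descend c (u ++ [i]) := by
  funext w
  simp [child, descend]

lemma descend_apply_nil (c : List ℕ → ℕ) (u : List ℕ) : descend c u [] = c u := by
  simp [descend]

lemma nil_mem_tree (c : List ℕ → ℕ) : [] ∈ tree c := by
  intro v i h
  simp at h

lemma append_singleton_mem_tree {c : List ℕ → ℕ} {u : List ℕ} {i : ℕ} :
    u ++ [i] ∈ tree c ↔ u ∈ tree c ∧ i < c u := by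
  constructor
  · exact fun h => ⟨fun v j hv => h v j (hv.trans (List.prefix_append _ _)), h u i List.prefix_rfl⟩
  · rintro ⟨h, hi⟩ v j hv
    rcases List.prefix_concat_iff.1 hv with heq | hv
    · obtain ⟨rfl, hj⟩ := List.append_inj' heq rfl
      obtain rfl : j = i := by simpa using hj
      exact hi
    · exact h v j hv

lemma append_mem_tree {c : List ℕ → ℕ} {u w : List ℕ} :
    u ++ w ∈ tree c ↔ u ∈ tree c ∧ w ∈ tree (descend c u) := by
  induction w using List.reverseRecOn with
  | nil => simp [nil_mem_tree]
  | append_singleton w i ih =>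
    rw [← List.append_assoc, append_singleton_mem_tree, append_singleton_mem_tree, ih, and_assoc]
    rfl

lemma cons_mem_tree {c : List ℕ → ℕ} {i : ℕ} {w : List ℕ} :
    i :: w ∈ tree c ↔ i < c [] ∧ w ∈ tree (child c i) := by
  rw [← List.singleton_append, append_mem_tree]
  have : [i] ∈ tree c ↔ i < c [] := by
    simpa [nil_mem_tree] using append_singleton_mem_tree (c := c) (u := []) (i := i)
  rw [this]
  rfl

/-! ### Iterated removal of P-positions -/

/-- The configurations in which some child of the root has its subtree in `B`. -/
def hasChild (B : Set (List ℕ → ℕ)) : Set (List ℕ → ℕ) := {c | ∃ i < c [], child c i ∈ B}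

lemma hasChild_mono {A B : Set (List ℕ → ℕ)} (h : A ⊆ B) : hasChild A ⊆ hasChild B :=
  fun _ ⟨i, hi, hA⟩ => ⟨i, hi, h hA⟩

/-- `R` is the set of configurations whose root remains in the game; `pWithin R n` consists of those
from which the second player wins within `n` rounds. -/
def pWithin (R : Set (List ℕ → ℕ)) : ℕ → Set (List ℕ → ℕ)
  | 0 => ∅
  | n + 1 => R ∩ (hasChild (R ∩ (hasChild (pWithin R n))ᶜ))ᶜ

/-- The P-positions of the game restricted to `R`. -/
def pPos (R : Set (List ℕ → ℕ)) : Set (List ℕ → ℕ) := ⋃ n, pWithin R n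

/-- The positions that remain after `k` rounds of removal of P-positions, other than draws. -/
def remaining : ℕ → Set (List ℕ → ℕ)
  | 0 => Set.univ
  | k + 1 => remaining k ∩ hasChild (pPos (remaining k))

/-- The P-positions of the game after `k` rounds of removal of P-positions. -/
abbrev stage (k : ℕ) : Set (List ℕ → ℕ) := pPos (remaining k)

lemma pWithin_subset (R : Set (List ℕ → ℕ)) (n : ℕ) : pWithin R n ⊆ R := by
  cases n with
  | zero => exact Set.empty_subset _
  | succ n => exact Set.inter_subset_left

lemma pPos_subset (R : Set (List ℕ → ℕ)) : pPos R ⊆ R :=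
  Set.iUnion_subset (pWithin_subset R)

lemma pWithin_mono (R : Set (List ℕ → ℕ)) : Monotone (pWithin R) := by
  refine monotone_nat_of_le_succ fun n => ?_
  induction n with
  | zero => exact Set.empty_subset _
  | succ n ih =>
    exact Set.inter_subset_inter_right _ (Set.compl_subset_compl.2 (hasChild_mono
      (Set.inter_subset_inter_right _ (Set.compl_subset_compl.2 (hasChild_mono ih)))))

lemma remaining_antitone : Antitone remaining :=
  antitone_nat_of_succ_le fun _ => Set.inter_subset_left

lemma exists_grandchild {R : Set (List ℕ → ℕ)} {n : ℕ} {c : List ℕ → ℕ} (h : c ∈ pWithin R (n + 1))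
    {i : ℕ} (hi : i < c []) (hR : child c i ∈ R) : child c i ∈ hasChild (pWithin R n) := by
  by_contra hcon
  exact h.2 ⟨i, hi, hR, hcon⟩

/-- Descent: if both vertices were second-player wins, the two winning replies would give another
such parent-child pair two generations lower with both bounds reduced. -/
lemma child_notMem_pWithin {R : Set (List ℕ → ℕ)} {n : ℕ} {c : List ℕ → ℕ} (h : c ∈ pWithin R n)
    {i : ℕ} (hi : i < c []) (m : ℕ) : child c i ∉ pWithin R m := by
  induction n generalizing m c i with
  | zero => exact h.elim
  | succ n ih =>
    intro hm
    obtain ⟨j, hj, hn⟩ := exists_grandchild h hi (pWithin_subset _ _ hm)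
    cases m with
    | zero => exact hm
    | succ m =>
      obtain ⟨l, hl, hm'⟩ := exists_grandchild hm hj (pWithin_subset _ _ hn)
      exact ih hn hl m hm'

lemma notMem_hasChild_pPos {R : Set (List ℕ → ℕ)} {c : List ℕ → ℕ} (h : c ∈ pPos R) :
    c ∉ hasChild (pPos R) := by
  rintro ⟨i, hi, hc⟩
  obtain ⟨n, hn⟩ := Set.mem_iUnion.1 h
  obtain ⟨m, hm⟩ := Set.mem_iUnion.1 hc
  exact child_notMem_pWithin hn hi m hm

/-- To survive removal `j` a vertex needs a child in `stage j`, which no member of `stage j` has. -/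
lemma notMem_stage_of_mem_remaining {j k : ℕ} (hjk : j < k) {c : List ℕ → ℕ}
    (h : c ∈ remaining k) : c ∉ stage j :=
  fun hj => notMem_hasChild_pPos hj (remaining_antitone (Nat.succ_le_of_lt hjk) h).2

lemma stage_unique {j k : ℕ} {c : List ℕ → ℕ} (hj : c ∈ stage j) (hk : c ∈ stage k) : j = k := by
  rcases lt_trichotomy j k with h | h | h
  · exact (notMem_stage_of_mem_remaining h (pPos_subset _ hk) hj).elim
  · exact h
  · exact (notMem_stage_of_mem_remaining h (pPos_subset _ hj) hk).elim

lemma mem_hasChild_stage {j k : ℕ} (hjk : j < k) {c : List ℕ → ℕ} (h : c ∈ remaining k) :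
    c ∈ hasChild (stage j) :=
  (remaining_antitone (Nat.succ_le_of_lt hjk) h).2

/-- A vertex that is never removed has infinitely many children. -/
lemma exists_notMem_remaining (c : List ℕ → ℕ) : ∃ k, c ∉ remaining k := by
  refine ⟨c [] + 1, fun h => ?_⟩
  -- Pigeonhole: the stages are disjoint, so `c [] + 1` of them would need that many different
  -- children.
  have h' : ∀ j : Fin (c [] + 1), ∃ i : Fin (c []), child c i ∈ stage j := fun j => by
    obtain ⟨i, hi, hc⟩ := mem_hasChild_stage j.2 h
    exact ⟨⟨i, hi⟩, hc⟩
  choose f hf using h'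
  obtain ⟨a, b, hab, hfab⟩ := Fintype.exists_ne_map_eq_of_card_lt f (by simp)
  exact hab (Fin.ext (stage_unique (hf a) (hfab ▸ hf b)))

/-! ### Dependence on the tree only -/

/-- Membership in `B` depends on the tree only. -/
def TreeInvariant (B : Set (List ℕ → ℕ)) : Prop :=
  ∀ c c', tree c = tree c' → c ∈ B → c' ∈ B

lemma eq_iff_of_forall_lt {m n : ℕ} (h : ∀ i, i < m ↔ i < n) : m = n := by
  by_contra hne
  rcases lt_or_gt_of_ne hne with h' | h'
  · exact lt_irrefl _ ((h m).2 h')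
  · exact lt_irrefl _ ((h n).1 h')

lemma apply_eq_of_tree_eq {c c' : List ℕ → ℕ} (h : tree c = tree c') {u : List ℕ}
    (hu : u ∈ tree c) : c u = c' u := by
  refine eq_iff_of_forall_lt fun i => ?_
  have h1 := append_singleton_mem_tree (c := c) (u := u) (i := i)
  have h2 := append_singleton_mem_tree (c := c') (u := u) (i := i)
  rw [← h] at h2
  tauto

lemma tree_descend_eq {c c' : List ℕ → ℕ} (h : tree c = tree c') {u : List ℕ} (hu : u ∈ tree c) :
    tree (descend c u) = tree (descend c' u) := by
  ext w
  have h1 := append_mem_tree (c := c) (u := u) (w := w)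
  have h2 := append_mem_tree (c := c') (u := u) (w := w)
  rw [← h] at h2
  tauto

lemma tree_child_eq {c c' : List ℕ → ℕ} (h : tree c = tree c') {i : ℕ} (hi : i < c []) :
    tree (child c i) = tree (child c' i) :=
  tree_descend_eq h (cons_mem_tree.2 ⟨hi, nil_mem_tree _⟩)

lemma TreeInvariant.mem_iff {B : Set (List ℕ → ℕ)} (hB : TreeInvariant B) {c c' : List ℕ → ℕ}
    (h : tree c = tree c') : c ∈ B ↔ c' ∈ B := ⟨hB c c' h, hB c' c h.symm⟩

lemma TreeInvariant.compl {B : Set (List ℕ → ℕ)} (hB : TreeInvariant B) : TreeInvariant Bᶜ :=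
  fun c c' h hc hc' => hc (hB c' c h.symm hc')

lemma TreeInvariant.inter {A B : Set (List ℕ → ℕ)} (hA : TreeInvariant A) (hB : TreeInvariant B) :
    TreeInvariant (A ∩ B) := fun c c' h hc => ⟨hA c c' h hc.1, hB c c' h hc.2⟩

lemma TreeInvariant.iUnion {ι : Type*} {B : ι → Set (List ℕ → ℕ)} (hB : ∀ i, TreeInvariant (B i)) :
    TreeInvariant (⋃ i, B i) := fun c c' h hc => by
  obtain ⟨i, hi⟩ := Set.mem_iUnion.1 hc
  exact Set.mem_iUnion.2 ⟨i, hB i c c' h hi⟩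

lemma TreeInvariant.hasChild {B : Set (List ℕ → ℕ)} (hB : TreeInvariant B) :
    TreeInvariant (hasChild B) := by
  rintro c c' h ⟨i, hi, hc⟩
  exact ⟨i, (apply_eq_of_tree_eq h (nil_mem_tree c)) ▸ hi, hB _ _ (tree_child_eq h hi) hc⟩

lemma TreeInvariant.forall_descend {B : Set (List ℕ → ℕ)} (hB : TreeInvariant B) :
    TreeInvariant {c | ∀ u ∈ tree c, descend c u ∈ B} :=
  fun _ _ h hc u hu => hB _ _ (tree_descend_eq h (h ▸ hu)) (hc u (h ▸ hu))

lemma TreeInvariant.pWithin {R : Set (List ℕ → ℕ)} (hR : TreeInvariant R) (n : ℕ) :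
    TreeInvariant (pWithin R n) := by
  induction n with
  | zero => exact fun _ _ _ h => h
  | succ n ih => exact hR.inter (hR.inter ih.hasChild.compl).hasChild.compl

lemma TreeInvariant.pPos {R : Set (List ℕ → ℕ)} (hR : TreeInvariant R) : TreeInvariant (pPos R) :=
  .iUnion hR.pWithin

lemma treeInvariant_remaining (k : ℕ) : TreeInvariant (remaining k) := by
  induction k with
  | zero => exact fun _ _ _ _ => trivial
  | succ k ih => exact ih.inter ih.pPos.hasChild

lemma treeInvariant_stage (k : ℕ) : TreeInvariant (stage k) := (treeInvariant_remaining k).pPos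

/-- The family sizes of a tree. -/
noncomputable def familySize (t : Set (List ℕ)) (u : List ℕ) : ℕ := sInf {i : ℕ | u ++ [i] ∉ t}

lemma familySize_tree {c : List ℕ → ℕ} {u : List ℕ} (hu : u ∈ tree c) :
    familySize (tree c) u = c u := by
  have : {i : ℕ | u ++ [i] ∉ tree c} = Set.Ici (c u) := by
    ext i
    simp [append_singleton_mem_tree, hu]
  rw [familySize, this, csInf_Ici]

/-- Only the tree is recovered: off the tree `familySize` is `0`, whatever `c` is there. This is why
events are required to be `TreeInvariant`. -/
lemma tree_familySize_tree (c : List ℕ → ℕ) : tree (familySize (tree c)) = tree c := by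
  ext u
  induction u using List.reverseRecOn with
  | nil => simp [nil_mem_tree]
  | append_singleton u i ih =>
    rw [append_singleton_mem_tree, append_singleton_mem_tree, ih]
    exact and_congr_right fun hu => by rw [familySize_tree hu]

/-! ### Positions of the game on a tree -/

lemma adj_graph_tree {c : List ℕ → ℕ} {u v : tree c} :
    (graph (tree c)).Adj u v ↔ ∃ i < c u, (v : List ℕ) = u ++ [i] := by
  refine ⟨fun ⟨i, hi⟩ => ⟨i, ?_, hi⟩, fun ⟨i, _, hi⟩ => ⟨i, hi⟩⟩
  exact (append_singleton_mem_tree.1 (hi ▸ v.2)).2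

lemma finite_options_graph_tree (c : List ℕ → ℕ) (u : tree c) :
    {v | (graph (tree c)).Adj u v}.Finite := by
  have : ((fun v : tree c => (v : List ℕ)) '' {v | (graph (tree c)).Adj u v}).Finite := by
    refine ((Set.finite_lt_nat (c u)).image fun i => (u : List ℕ) ++ [i]).subset ?_
    rintro _ ⟨v, hv, rfl⟩
    obtain ⟨i, hi, hvi⟩ := adj_graph_tree.1 hv
    exact ⟨i, hi, hvi.symm⟩
  exact this.of_finite_image Subtype.val_injective.injOn

lemma exists_adj_iff {c : List ℕ → ℕ} (u : tree c) {p : tree c → Prop} {B : Set (List ℕ → ℕ)}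
    (hp : ∀ v, p v ↔ descend c v ∈ B) :
    (∃ v, (graph (tree c)).Adj u v ∧ p v) ↔ descend c u ∈ hasChild B := by
  simp only [hasChild, Set.mem_ofPred_eq, descend_apply_nil, child_descend]
  constructor
  · rintro ⟨v, hv, hpv⟩
    obtain ⟨i, hi, hvi⟩ := adj_graph_tree.1 hv
    exact ⟨i, hi, hvi ▸ (hp v).1 hpv⟩
  · rintro ⟨i, hi, hB⟩
    exact ⟨⟨u ++ [i], append_singleton_mem_tree.2 ⟨u.2, hi⟩⟩, ⟨i, rfl⟩, (hp _).2 hB⟩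

lemma pWithin_graph_iff {c : List ℕ → ℕ} (n : ℕ) (u : tree c) :
    (graph (tree c)).PWithin n u ↔ descend c u ∈ pWithin (remaining 0) n := by
  induction n generalizing u with
  | zero => rfl
  | succ n ih =>
    have h1 : ∀ v : tree c, ¬ (∃ z, (graph (tree c)).Adj v z ∧ (graph (tree c)).PWithin n z) ↔
        descend c v ∈ (hasChild (pWithin (remaining 0) n))ᶜ := fun v =>
      not_congr (exists_adj_iff v ih)
    have h2 := not_congr (exists_adj_iff u h1)
    simp only [pWithin, remaining, Set.univ_inter] at h2 ⊢
    rw [Set.mem_compl_iff, ← h2]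
    simp only [Digraph.PWithin, not_exists, not_and]
    push Not
    rfl

lemma isPPos_graph_iff {c : List ℕ → ℕ} (u : tree c) :
    (graph (tree c)).IsPPos u ↔ descend c u ∈ stage 0 := by
  rw [Digraph.isPPos_iff (finite_options_graph_tree c), stage, pPos, Set.mem_iUnion]
  exact exists_congr fun n => pWithin_graph_iff n u

lemma isNPos_graph_iff {c : List ℕ → ℕ} (u : tree c) :
    (graph (tree c)).IsNPos u ↔ descend c u ∈ remaining 1 := by
  rw [Digraph.isNPos_iff (finite_options_graph_tree c), remaining, remaining, Set.univ_inter]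
  refine exists_adj_iff u fun v => ?_
  rw [← Digraph.isPPos_iff (finite_options_graph_tree c), isPPos_graph_iff]
  rfl

lemma rootP_iff (c : List ℕ → ℕ) : RootP (tree c) ↔ c ∈ stage 0 := by
  simp [RootP, nil_mem_tree, isPPos_graph_iff]

lemma rootN_iff (c : List ℕ → ℕ) : RootN (tree c) ↔ c ∈ remaining 1 := by
  simp [RootN, nil_mem_tree, isNPos_graph_iff]

lemma rootD_iff (c : List ℕ → ℕ) : RootD (tree c) ↔ c ∈ (stage 0)ᶜ ∩ (remaining 1)ᶜ := by
  simp [RootD, nil_mem_tree, Digraph.IsDPos, isPPos_graph_iff, isNPos_graph_iff, and_comm]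

lemma drawFree_of_forall_stage {c : List ℕ → ℕ} (h : ∀ u ∈ tree c, descend c u ∈ ⋃ k, stage k) :
    (graph (tree c)).DrawFree := by
  rintro u ⟨hN, hP⟩
  rw [isNPos_graph_iff] at hN
  rw [isPPos_graph_iff] at hP
  obtain ⟨k, hk⟩ := Set.mem_iUnion.1 (h u u.2)
  cases k with
  | zero => exact hP hk
  | succ k => exact hN (remaining_antitone (by lia) (pPos_subset _ hk))

/-- The value `g` is the index of the stage and `d` the least number of rounds. An option `y` of
larger value is still present at stage `g x`, so the second player's reply to it lies in that stage
and wins in fewer rounds. -/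
lemma rank_ne_top_of_forall_stage {c : List ℕ → ℕ}
    (h : ∀ u ∈ tree c, descend c u ∈ ⋃ k, stage k) (u : tree c) : (graph (tree c)).rank u ≠ ⊤ := by
  classical
  have h1 : ∀ u : tree c, ∃ k, descend c u ∈ stage k := fun u => Set.mem_iUnion.1 (h u u.2)
  choose g hg using h1
  have h2 : ∀ u : tree c, ∃ n, descend c u ∈ pWithin (remaining (g u)) n :=
    fun u => Set.mem_iUnion.1 (hg u)
  have hmem : ∀ (u : tree c) {i : ℕ}, i < c u → (u : List ℕ) ++ [i] ∈ tree c :=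
    fun u i hi => append_singleton_mem_tree.2 ⟨u.2, hi⟩
  refine Digraph.rank_ne_top (finite_options_graph_tree c) (g := g) (d := fun u => Nat.find (h2 u))
    (fun x j hj => ?_) (fun x y hxy heq => ?_) (fun x y hxy hlt => ?_) u
  · obtain ⟨i, hi, hc⟩ := mem_hasChild_stage hj (pPos_subset _ (hg x))
    rw [descend_apply_nil] at hi
    rw [child_descend] at hc
    exact ⟨⟨_, hmem x hi⟩, ⟨i, rfl⟩, stage_unique (hg ⟨_, hmem x hi⟩) hc⟩
  · obtain ⟨i, hi, hy⟩ := adj_graph_tree.1 hxy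
    refine notMem_hasChild_pPos (hg x) ⟨i, by rwa [descend_apply_nil], ?_⟩
    rw [child_descend, ← hy, ← heq]
    exact hg y
  · obtain ⟨i, hi, hy⟩ := adj_graph_tree.1 hxy
    have hx := Nat.find_spec (h2 x)
    -- `pWithin R 0` is empty.
    have hpos : Nat.find (h2 x) ≠ 0 := fun h0 => by rw [h0] at hx; exact hx
    obtain ⟨n, hn⟩ := Nat.exists_eq_succ_of_ne_zero hpos
    rw [hn] at hx
    have hyR : child (descend c x) i ∈ remaining (g x) := by
      rw [child_descend, ← hy]
      exact remaining_antitone hlt.le (pPos_subset _ (hg y))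
    obtain ⟨j, hj, hz⟩ := exists_grandchild hx (by rwa [descend_apply_nil]) hyR
    rw [child_descend, ← hy] at hj hz
    rw [descend_apply_nil] at hj
    rw [child_descend] at hz
    have hgz : g ⟨_, hmem y hj⟩ = g x :=
      stage_unique (hg ⟨_, hmem y hj⟩) (Set.mem_iUnion.2 ⟨n, hz⟩)
    refine ⟨⟨_, hmem y hj⟩, ⟨j, rfl⟩, hgz, ?_⟩
    rw [hn, Nat.lt_succ_iff]
    refine Nat.find_min' _ ?_
    rw [hgz]
    exact hz

/-! ### Finite trees -/

/-- The configurations in which no individual of generation `n` is born. -/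
def extinctBy : ℕ → Set (List ℕ → ℕ)
  | 0 => ∅
  | n + 1 => (hasChild (extinctBy n)ᶜ)ᶜ

lemma mem_extinctBy_iff {n : ℕ} {c : List ℕ → ℕ} :
    c ∈ extinctBy n ↔ ∀ u ∈ tree c, u.length < n := by
  induction n generalizing c with
  | zero => simpa [extinctBy] using ⟨[], nil_mem_tree c⟩
  | succ n ih =>
    simp only [extinctBy, hasChild, Set.mem_compl_iff, ih, Set.mem_ofPred_eq, not_exists,
      not_and, not_not]
    constructor
    · rintro h (_ | ⟨i, w⟩) hu
      · simp
      · rw [cons_mem_tree] at hu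
        simpa using h i hu.1 w hu.2
    · intro h i hi w hw
      simpa using h (i :: w) (cons_mem_tree.2 ⟨hi, hw⟩)

lemma extinctBy_mono : Monotone extinctBy :=
  monotone_nat_of_le_succ fun _ _ h =>
    mem_extinctBy_iff.2 fun u hu => (mem_extinctBy_iff.1 h u hu).trans (Nat.lt_succ_self _)

lemma finite_tree_of_mem_extinctBy {n : ℕ} {c : List ℕ → ℕ} (h : c ∈ extinctBy n) :
    (tree c).Finite := by
  induction n generalizing c with
  | zero => exact h.elim
  | succ n ih =>
    have hsub : tree c ⊆ {[]} ∪ ⋃ i ∈ Set.Iio (c []), (fun w => i :: w) '' tree (child c i) := by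
      rintro (_ | ⟨i, w⟩) hu
      · simp
      · rw [cons_mem_tree] at hu
        exact Or.inr (Set.mem_biUnion hu.1 ⟨w, hu.2, rfl⟩)
    refine ((Set.finite_singleton _).union ((Set.finite_Iio _).biUnion fun i hi => ?_)).subset hsub
    refine (ih ?_).image _
    by_contra hcon
    exact h ⟨i, hi, hcon⟩

lemma infinite_tree_iff (c : List ℕ → ℕ) : (tree c).Infinite ↔ c ∈ (⋃ n, extinctBy n)ᶜ := by
  rw [Set.Infinite, Set.mem_compl_iff, not_iff_not, Set.mem_iUnion]
  refine ⟨fun h => ?_, fun ⟨n, hn⟩ => finite_tree_of_mem_extinctBy hn⟩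
  obtain ⟨M, hM⟩ := (h.image List.length).bddAbove
  exact ⟨M + 1, mem_extinctBy_iff.2 fun u hu => Nat.lt_succ_of_le (hM ⟨u, hu, rfl⟩)⟩

/-! ### The reduced tree -/

/-- The configurations whose reduced tree contains the given word. -/
def reducedMem : List ℕ → Set (List ℕ → ℕ)
  | [] => Set.univ
  | i :: w => {c | ∃ j < c [], child c j ∉ stage 0 ∧
      {j' | j' < j ∧ child c j' ∉ stage 0}.ncard = i ∧ child c j ∈ reducedMem w}

/-- The reduced tree, as a function of the family sizes. -/
def reduced (c : List ℕ → ℕ) : Set (List ℕ) := {w | c ∈ reducedMem w}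

lemma treeInvariant_reducedMem (w : List ℕ) : TreeInvariant (reducedMem w) := by
  induction w with
  | nil => exact fun _ _ _ _ => trivial
  | cons i w ih =>
    rintro c c' h ⟨j, hj, hP, hcard, hw⟩
    have hc := apply_eq_of_tree_eq h (nil_mem_tree c)
    have hst : ∀ j < c [], (child c' j ∉ stage 0 ↔ child c j ∉ stage 0) := fun j hj =>
      ((treeInvariant_stage 0).compl.mem_iff (tree_child_eq h hj)).symm
    refine ⟨j, hc ▸ hj, (hst j hj).2 hP, ?_, ih _ _ (tree_child_eq h hj) hw⟩
    rw [← hcard]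
    congr 1
    ext j'
    exact and_congr_right fun hj' => hst j' (hj'.trans hj)

/-- The individuals of which no ancestor and not themselves are P-positions. -/
def nonPComponent (c : List ℕ → ℕ) : Set (List ℕ) :=
  {u | u ∈ tree c ∧ ∀ v, v <+: u → descend c v ∉ stage 0}

lemma mem_removeP_tree {c : List ℕ → ℕ} {u : List ℕ} :
    u ∈ removeP (tree c) ↔ u ∈ tree c ∧ descend c u ∉ stage 0 := by
  simp only [removeP, Set.mem_ofPred_eq, isPPos_graph_iff, exists_prop]

lemma append_singleton_mem_nonPComponent {c : List ℕ → ℕ} {u : List ℕ} {i : ℕ} :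
    u ++ [i] ∈ nonPComponent c ↔ u ∈ nonPComponent c ∧ u ++ [i] ∈ removeP (tree c) := by
  simp only [nonPComponent, Set.mem_ofPred_eq, mem_removeP_tree, append_singleton_mem_tree,
    List.prefix_concat_iff]
  constructor
  · exact fun ⟨h1, h2⟩ => ⟨⟨h1.1, fun v hv => h2 v (Or.inr hv)⟩, h1, h2 _ (Or.inl rfl)⟩
  · rintro ⟨⟨_, h2⟩, h3, h4⟩
    refine ⟨h3, fun v hv => ?_⟩
    rcases hv with rfl | hv
    · exact h4
    · exact h2 v hv

/-- Each arc of the remaining graph either has both ends in `nonPComponent c` or neither, so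
undirected paths from the root never leave it; conversely every prefix of a member is a member. -/
lemma rootComponent_removeP_tree (c : List ℕ → ℕ) :
    rootComponent (removeP (tree c)) = nonPComponent c := by
  ext u
  constructor
  · rintro ⟨h₀, h, heqv⟩
    have key : ∀ x y : removeP (tree c),
        Relation.EqvGen (graph (removeP (tree c))).Adj x y →
        ((x : List ℕ) ∈ nonPComponent c ↔ (y : List ℕ) ∈ nonPComponent c) := by
      intro x y hxy
      induction hxy with
      | rel x y hxy =>
        obtain ⟨i, hi⟩ := hxy
        have := y.2
        rw [hi] at this ⊢
        rw [append_singleton_mem_nonPComponent]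
        exact ⟨fun h => ⟨h, this⟩, fun h => h.1⟩
      | refl => rfl
      | symm _ _ _ ih => exact ih.symm
      | trans _ _ _ _ _ ih1 ih2 => exact ih1.trans ih2
    refine (key _ _ heqv).1 ⟨nil_mem_tree c, fun v hv => ?_⟩
    rw [List.prefix_nil.1 hv]
    exact (mem_removeP_tree.1 h₀).2
  · intro hu
    induction u using List.reverseRecOn with
    | nil =>
      have h₀ : [] ∈ removeP (tree c) := mem_removeP_tree.2 ⟨hu.1, hu.2 _ List.prefix_rfl⟩
      exact ⟨h₀, h₀, .refl _⟩
    | append_singleton u i ih =>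
      obtain ⟨h1, h2⟩ := append_singleton_mem_nonPComponent.1 hu
      obtain ⟨h₀, h, heqv⟩ := ih h1
      exact ⟨h₀, h2, heqv.trans _ _ _ (.rel _ _ ⟨i, rfl⟩)⟩

lemma cons_mem_nonPComponent {c : List ℕ → ℕ} {i : ℕ} {w : List ℕ} :
    i :: w ∈ nonPComponent c ↔ c ∉ stage 0 ∧ i < c [] ∧ w ∈ nonPComponent (child c i) := by
  simp only [nonPComponent, Set.mem_ofPred_eq, cons_mem_tree]
  constructor
  · exact fun ⟨h1, h2⟩ => ⟨h2 [] (List.nil_prefix), h1.1, h1.2, fun v hv =>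
      h2 (i :: v) (List.cons_prefix_cons.2 ⟨rfl, hv⟩)⟩
  · rintro ⟨h1, h2, h3, h4⟩
    refine ⟨⟨h2, h3⟩, fun v hv => ?_⟩
    rcases v with _ | ⟨j, v⟩
    · exact h1
    · obtain ⟨rfl, hvw⟩ := List.cons_prefix_cons.1 hv
      exact h4 v hvw

lemma nil_mem_nonPComponent {c : List ℕ → ℕ} : [] ∈ nonPComponent c ↔ c ∉ stage 0 := by
  simp [nonPComponent, nil_mem_tree]

lemma relabel_cons (S : Set (List ℕ)) (i : ℕ) (w : List ℕ) :
    relabel S (i :: w) =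
      Set.ncard {j : ℕ | j < i ∧ [j] ∈ S} :: relabel {w' | i :: w' ∈ S} w := rfl

lemma relabel_nonPComponent_cons {c : List ℕ → ℕ} (hc : c ∉ stage 0) {j : ℕ} (hj : j < c [])
    (w : List ℕ) : relabel (nonPComponent c) (j :: w) =
      {j' | j' < j ∧ child c j' ∉ stage 0}.ncard :: relabel (nonPComponent (child c j)) w := by
  rw [relabel_cons]
  congr 2
  · ext j'
    refine and_congr_right fun hj' => ?_
    simp [cons_mem_nonPComponent, nil_mem_nonPComponent, hc, hj'.trans hj]
  · ext w'
    simp [cons_mem_nonPComponent, hc, hj]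

lemma mem_image_relabel_iff {c : List ℕ → ℕ} (hc : c ∉ stage 0) {v : List ℕ} :
    v ∈ relabel (nonPComponent c) '' nonPComponent c ↔ c ∈ reducedMem v := by
  induction v generalizing c with
  | nil =>
    refine ⟨fun _ => trivial, fun _ => ⟨[], nil_mem_nonPComponent.2 hc, rfl⟩⟩
  | cons i v ih =>
    constructor
    · rintro ⟨u, hu, huv⟩
      rcases u with _ | ⟨j, w⟩
      · simp [relabel] at huv
      · obtain ⟨-, hj, hw⟩ := cons_mem_nonPComponent.1 hu
        have hcj : child c j ∉ stage 0 := hw.2 [] List.nil_prefix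
        rw [relabel_nonPComponent_cons hc hj, List.cons.injEq] at huv
        exact ⟨j, hj, hcj, huv.1, (ih hcj).1 ⟨w, hw, huv.2⟩⟩
    · rintro ⟨j, hj, hcj, hcard, hv⟩
      obtain ⟨w, hw, hwv⟩ := (ih hcj).2 hv
      refine ⟨j :: w, cons_mem_nonPComponent.2 ⟨hc, hj, hw⟩, ?_⟩
      rw [relabel_nonPComponent_cons hc hj, hcard, hwv]

lemma reducedTree_tree {c : List ℕ → ℕ} (hc : c ∉ stage 0) : reducedTree (tree c) = reduced c := by
  ext v
  rw [reducedTree, rootComponent_removeP_tree, mem_image_relabel_iff hc]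
  rfl

/-! ### Independence of the subtrees of the children of the root -/

/-- The law of the family sizes. -/
noncomputable abbrev sizes (p : Measure ℕ) : Measure (List ℕ → ℕ) :=
  Measure.infinitePi (fun _ : List ℕ => p)

/-- The configuration with given size of the family of the root and given subtrees of the
children. -/
def join (x : ℕ × (ℕ → List ℕ → ℕ)) : List ℕ → ℕ
  | [] => x.1
  | i :: w => x.2 i w

lemma measurable_join : Measurable join := by
  refine measurable_pi_iff.2 fun w => ?_
  cases w with
  | nil => exact measurable_fst
  | cons i w => exact (measurable_pi_apply w).comp ((measurable_pi_apply i).comp measurable_snd)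

lemma measurable_child (i : ℕ) : Measurable fun c : List ℕ → ℕ => child c i :=
  measurable_pi_iff.2 fun w => measurable_pi_apply (i :: w)

lemma measurable_descend (u : List ℕ) : Measurable fun c : List ℕ → ℕ => descend c u :=
  measurable_pi_iff.2 fun w => measurable_pi_apply (u ++ w)

/-- Sorting words by their first letter matches the split of a configuration into root and child
subtrees made by `join`. -/
lemma prod_finset_list {M : Type*} [CommMonoid M] (s : Finset (List ℕ)) (f : List ℕ → M) :
    ∏ w ∈ s, f w = (if [] ∈ s then f [] else 1) *
      ∏ i ∈ s.image (fun w => w.headD 0),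
        ∏ w ∈ s.preimage (i :: ·) (List.cons_injective.injOn), f (i :: w) := by
  classical
  rw [← Finset.prod_filter_mul_prod_filter_not s (fun w => w = [])]
  congr 1
  · rw [Finset.prod_filter, Finset.prod_ite_eq' s [] f]
  · rw [Finset.prod_sigma']
    symm
    refine Finset.prod_bij (fun x _ => x.1 :: x.2) ?_ ?_ ?_ ?_
    · rintro ⟨i, w⟩ h
      simp only [Finset.mem_sigma, Finset.mem_preimage] at h
      simpa using h.2
    · rintro ⟨i, w⟩ _ ⟨j, v⟩ _ h
      simpa using h
    · rintro w hw
      rw [Finset.mem_filter] at hw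
      cases w with
      | nil => simp at hw
      | cons i w =>
        exact ⟨⟨i, w⟩, by simpa using ⟨⟨_, hw.1, rfl⟩, hw.1⟩, rfl⟩
    · rintro ⟨i, w⟩ _
      rfl

variable (p : Measure ℕ) [IsProbabilityMeasure p]

lemma map_join : (p.prod (Measure.infinitePi fun _ : ℕ => sizes p)).map join = sizes p := by
  classical
  refine Measure.eq_infinitePi _ fun s t ht => ?_
  have hms : ∀ i, MeasurableSet (Set.pi
      (s.preimage (i :: ·) (List.cons_injective.injOn) : Finset (List ℕ)) fun w => t (i :: w)) :=
    fun i => MeasurableSet.pi (Finset.countable_toSet _) fun w _ => ht _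
  rw [Measure.map_apply measurable_join (MeasurableSet.pi s.countable_toSet fun w _ => ht w)]
  have hpre : join ⁻¹' (Set.pi s t) = (if [] ∈ s then t [] else Set.univ) ×ˢ
      Set.pi (s.image (fun w => w.headD 0) : Finset ℕ) (fun i =>
        Set.pi (s.preimage (i :: ·) (List.cons_injective.injOn) : Finset (List ℕ))
          fun w => t (i :: w)) := by
    ext ⟨n, f⟩
    simp only [Set.mem_preimage, Set.mem_pi, Set.mem_prod, Finset.mem_coe, Finset.mem_preimage]
    constructor
    · intro h
      refine ⟨?_, fun i _ w hw => h (i :: w) hw⟩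
      split_ifs with h0
      · exact h [] h0
      · trivial
    · rintro ⟨h1, h2⟩ (_ | ⟨i, w⟩) hw
      · rwa [if_pos hw] at h1
      · exact h2 i (Finset.mem_image.2 ⟨_, hw, rfl⟩) w hw
  rw [hpre, Measure.prod_prod, Measure.infinitePi_pi _ fun i _ => hms i, prod_finset_list]
  congr 1
  · split_ifs <;> simp
  · refine Finset.prod_congr rfl fun i _ => ?_
    rw [Measure.infinitePi_pi _ fun w _ => ht _]

lemma measurableSet_root_children (A : Set ℕ) (n : ℕ) {B : ℕ → Set (List ℕ → ℕ)}
    (hB : ∀ i, MeasurableSet (B i)) :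
    MeasurableSet {c : List ℕ → ℕ | c [] ∈ A ∧ ∀ i < n, child c i ∈ B i} := by
  refine MeasurableSet.inter (measurable_pi_apply [] (MeasurableSet.of_discrete (s := A))) ?_
  have : {c : List ℕ → ℕ | ∀ i < n, child c i ∈ B i} =
      ⋂ i ∈ Set.Iio n, (fun c => child c i) ⁻¹' B i := by ext; simp
  change MeasurableSet {c : List ℕ → ℕ | ∀ i < n, child c i ∈ B i}
  rw [this]
  exact MeasurableSet.biInter (Set.to_countable _) fun i _ => measurable_child i (hB i)

/-- The branching property. The number `n` is deterministic so that the classes may vary with `i`; a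
random family size is treated by slicing over `c []`. -/
lemma sizes_root_children {A : Set ℕ} (n : ℕ) {B : ℕ → Set (List ℕ → ℕ)}
    (hB : ∀ i, MeasurableSet (B i)) :
    sizes p {c | c [] ∈ A ∧ ∀ i < n, child c i ∈ B i} =
      p A * ∏ i ∈ Finset.range n, sizes p (B i) := by
  have hm := measurableSet_root_children A n hB
  conv_lhs => rw [← map_join p, Measure.map_apply measurable_join hm]
  have : join ⁻¹' {c : List ℕ → ℕ | c [] ∈ A ∧ ∀ i < n, child c i ∈ B i} =
      A ×ˢ Set.pi (Finset.range n : Finset ℕ) B := by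
    ext ⟨k, f⟩
    have hf : ∀ i, child (join (k, f)) i = f i := fun i => rfl
    simp [hf, join, Set.mem_pi]
  rw [this, Measure.prod_prod, Measure.infinitePi_pi _ fun i _ => hB i]

lemma map_child (i : ℕ) : (sizes p).map (fun c => child c i) = sizes p := by
  refine Measure.ext fun B hB => ?_
  rw [Measure.map_apply (measurable_child i) hB]
  have := sizes_root_children p (A := Set.univ) (i + 1)
    (B := fun j => if j = i then B else Set.univ) (fun j => by split_ifs <;> simp [hB])
  rw [Finset.prod_eq_single i (by intro j _ hj; simp [hj]) (by simp)] at this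
  simp only [measure_univ, if_true, one_mul] at this
  rw [← this]
  congr 1
  ext c
  simp only [Set.mem_preimage, Set.mem_ofPred_eq, Set.mem_univ, true_and]
  constructor
  · intro h j _
    split_ifs with hj
    · exact hj ▸ h
    · trivial
  · intro h
    simpa using h i (Nat.lt_succ_self i)

lemma map_descend (u : List ℕ) : (sizes p).map (fun c => descend c u) = sizes p := by
  induction u with
  | nil => exact Measure.map_id
  | cons i u ih =>
    have : (fun c : List ℕ → ℕ => descend c (i :: u)) =
        (fun c => descend c u) ∘ fun c => child c i := rfl
    rw [this, ← Measure.map_map (measurable_descend u) (measurable_child i), map_child, ih]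

/-- Every subtree has the law of the whole, and there are countably many words. -/
lemma ae_forall_descend {B : Set (List ℕ → ℕ)} (hB : ∀ᵐ c ∂sizes p, c ∈ B) :
    ∀ᵐ c ∂sizes p, ∀ u, descend c u ∈ B := by
  rw [ae_all_iff]
  intro u
  rw [← map_descend p u] at hB
  exact ae_of_ae_map (measurable_descend u).aemeasurable hB

lemma sizes_forall_children {B : Set (List ℕ → ℕ)} (hB : MeasurableSet B) :
    sizes p {c | ∀ i < c [], child c i ∈ B} = ∑' n, p {n} * sizes p B ^ n := by
  have : {c : List ℕ → ℕ | ∀ i < c [], child c i ∈ B} =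
      ⋃ n, {c | c [] ∈ ({n} : Set ℕ) ∧ ∀ i < n, child c i ∈ B} := by
    ext c
    simp
  rw [this, measure_iUnion]
  · refine tsum_congr fun n => ?_
    rw [sizes_root_children p n fun _ => hB, Finset.prod_const, Finset.card_range]
  · intro m n hmn
    refine Set.disjoint_left.2 fun c hm hn => hmn ?_
    exact (Set.mem_singleton_iff.1 hm.1).symm.trans (Set.mem_singleton_iff.1 hn.1)
  · intro n
    exact measurableSet_root_children _ n fun _ => hB

/-! ### Measurability -/

lemma measurableSet_hasChild {B : Set (List ℕ → ℕ)} (hB : MeasurableSet B) :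
    MeasurableSet (hasChild B) := by
  have : hasChild B = ⋃ i, {c | i < c []} ∩ (fun c => child c i) ⁻¹' B := by
    ext c
    simp [hasChild]
  rw [this]
  exact .iUnion fun i =>
    (measurable_pi_apply [] (MeasurableSet.of_discrete (s := {n | i < n}))).inter
      (measurable_child i hB)

lemma measurableSet_pWithin {R : Set (List ℕ → ℕ)} (hR : MeasurableSet R) (n : ℕ) :
    MeasurableSet (pWithin R n) := by
  induction n with
  | zero => exact .empty
  | succ n ih =>
    exact hR.inter (measurableSet_hasChild (hR.inter (measurableSet_hasChild ih).compl)).compl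

lemma measurableSet_pPos {R : Set (List ℕ → ℕ)} (hR : MeasurableSet R) : MeasurableSet (pPos R) :=
  .iUnion (measurableSet_pWithin hR)

lemma measurableSet_remaining (k : ℕ) : MeasurableSet (remaining k) := by
  induction k with
  | zero => exact .univ
  | succ k ih => exact ih.inter (measurableSet_hasChild (measurableSet_pPos ih))

lemma measurableSet_stage (k : ℕ) : MeasurableSet (stage k) :=
  measurableSet_pPos (measurableSet_remaining k)

lemma measurableSet_extinctBy (n : ℕ) : MeasurableSet (extinctBy n) := by
  induction n with
  | zero => exact .empty
  | succ n ih => exact (measurableSet_hasChild ih.compl).compl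

lemma measurable_ncard_children {B : Set (List ℕ → ℕ)} (hB : MeasurableSet B) (j : ℕ) :
    Measurable fun c : List ℕ → ℕ => {i | i < j ∧ child c i ∈ B}.ncard := by
  classical
  have : (fun c : List ℕ → ℕ => {i | i < j ∧ child c i ∈ B}.ncard) =
      fun c => ∑ i ∈ Finset.range j, if child c i ∈ B then 1 else 0 := by
    funext c
    rw [← Finset.card_filter, ← Set.ncard_coe_finset]
    congr 1
    ext i
    simp
  rw [this]
  exact Finset.measurable_sum _ fun i _ =>
    Measurable.ite (measurable_child i hB) measurable_const measurable_const

lemma measurableSet_reducedMem (w : List ℕ) : MeasurableSet (reducedMem w) := by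
  induction w with
  | nil => exact .univ
  | cons i w ih =>
    have : reducedMem (i :: w) = ⋃ j, {c | j < c []} ∩ ((fun c => child c j) ⁻¹' (stage 0)ᶜ ∩
        ({c | {j' | j' < j ∧ child c j' ∈ (stage 0)ᶜ}.ncard = i} ∩
          (fun c => child c j) ⁻¹' reducedMem w)) := by
      ext c
      simp [reducedMem]
    rw [this]
    refine .iUnion fun j =>
      (measurable_pi_apply [] (MeasurableSet.of_discrete (s := {n | j < n}))).inter
        ((measurable_child j (measurableSet_stage 0).compl).inter (.inter ?_
          (measurable_child j ih)))
    exact measurable_ncard_children (measurableSet_stage 0).compl j (measurableSet_singleton i)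

lemma measurable_reduced : Measurable reduced :=
  measurable_set_iff.2 fun w => measurableSet_setOfPred.1 (measurableSet_reducedMem w)

lemma measurable_tree : Measurable tree := by
  refine measurable_set_iff.2 fun u => ?_
  refine Measurable.forall fun v => Measurable.forall fun i => ?_
  refine Measurable.imp measurable_const ?_
  exact measurableSet_setOfPred.1
    (measurable_pi_apply v (MeasurableSet.of_discrete (s := {n | i < n})))

lemma measurable_familySize : Measurable familySize := by
  refine measurable_pi_iff.2 fun u => measurable_of_Iic fun n => ?_
  -- If `t` contains every `u ++ [i]`, the infimum is over the empty set and equals `0`, hence the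
  -- last intersection.
  have : (fun t : Set (List ℕ) => familySize t u) ⁻¹' Set.Iic n =
      (⋃ i ∈ Set.Iic n, {t | u ++ [i] ∉ t}) ∪ ⋂ i, {t | u ++ [i] ∈ t} := by
    ext t
    simp only [Set.mem_preimage, Set.mem_Iic, Set.mem_union, Set.mem_iUnion, Set.mem_iInter,
      Set.mem_ofPred_eq, exists_prop, familySize]
    constructor
    · intro h
      rcases Set.eq_empty_or_nonempty {i : ℕ | u ++ [i] ∉ t} with h0 | h0
      · exact Or.inr fun i => by
          by_contra hi
          exact (h0 ▸ hi : i ∈ (∅ : Set ℕ))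
      · exact Or.inl ⟨_, h, Nat.sInf_mem h0⟩
    · rintro (⟨i, hi, hmem⟩ | h)
      · exact (Nat.sInf_le hmem).trans hi
      · simp [h]
  rw [this]
  exact (MeasurableSet.biUnion (Set.to_countable _) fun i _ => measurableSet_notMem _).union
    (.iInter fun i => measurableSet_mem _)

/-! ### Fixed points -/

lemma mul_exp_neg_le (s : ℝ) : s * Real.exp (-s) ≤ Real.exp (-1) := by
  have h := Real.add_one_le_exp (s - 1)
  calc s * Real.exp (-s) ≤ Real.exp (s - 1) * Real.exp (-s) := by gcongr; linarith
    _ = Real.exp (-1) := by rw [← Real.exp_add]; ring_nf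

lemma mul_exp_neg_lt {s : ℝ} (hs : s ≠ 1) : s * Real.exp (-s) < Real.exp (-1) := by
  have h := Real.add_one_lt_exp (sub_ne_zero.2 hs)
  calc s * Real.exp (-s) < Real.exp (s - 1) * Real.exp (-s) := by gcongr; linarith
    _ = Real.exp (-1) := by rw [← Real.exp_add]; ring_nf

/-- For `k ≤ e`, a point of period two of `t ↦ k * exp (-t)` is a fixed point. -/
lemma eq_of_two_cycle {k a b : ℝ} (hk0 : 0 < k) (hk : k ≤ Real.exp 1)
    (ha : a = k * Real.exp (-b)) (hb : b = k * Real.exp (-a)) : a = b := by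
  wlog hab : a < b generalizing a b
  · rcases (not_lt.1 hab).lt_or_eq with h | h
    · exact (this hb ha h).symm
    · exact h.symm
  exfalso
  -- With `s = k exp(-t)` the derivative of `h` is `1 - k s exp(-s) ≥ 1 - k/e ≥ 0`, and it can
  -- vanish only at `s = 1`, that is at `t = log k`.
  set h : ℝ → ℝ := fun t => t - k * Real.exp (-(k * Real.exp (-t))) with hdef
  have hd : ∀ t, HasDerivAt h
      (1 - k * (k * Real.exp (-t) * Real.exp (-(k * Real.exp (-t))))) t := by
    intro t
    have h1 : HasDerivAt (fun t : ℝ => -t) (-1) t := hasDerivAt_neg t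
    have h2 := ((h1.exp.const_mul k).neg).exp.const_mul k
    exact ((hasDerivAt_id t).sub h2).congr_deriv (by simp only [Pi.neg_apply]; ring)
  have hke : k * Real.exp (-1) ≤ 1 := by
    rw [Real.exp_neg, ← div_eq_mul_inv, div_le_one (Real.exp_pos 1)]
    exact hk
  have hnonneg : ∀ t, 0 ≤ deriv h t := fun t => by
    rw [(hd t).deriv]
    have := mul_le_mul_of_nonneg_left (mul_exp_neg_le (k * Real.exp (-t))) hk0.le
    linarith
  have hzero : ∀ t, deriv h t = 0 → t = Real.log k := fun t ht => by
    by_contra hne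
    rw [(hd t).deriv] at ht
    have hs : k * Real.exp (-t) ≠ 1 := fun h1 => hne <| by
      rw [Real.exp_neg, ← div_eq_mul_inv, div_eq_one_iff_eq (Real.exp_ne_zero t)] at h1
      rw [h1, Real.log_exp]
    have := mul_lt_mul_of_pos_left (mul_exp_neg_lt hs) hk0
    linarith
  have hmono : Monotone h :=
    monotone_of_deriv_nonneg (fun t => (hd t).differentiableAt) hnonneg
  have hcont : Continuous h := continuous_iff_continuousAt.2 fun t => (hd t).continuousAt
  have ha0 : h a = 0 := by simp only [hdef]; rw [← hb, ← ha, sub_self]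
  have hb0 : h b = 0 := by simp only [hdef]; rw [← ha, ← hb, sub_self]
  have hm1 : a < (a + b) / 2 := by linarith
  have hm2 : (a + b) / 2 < b := by linarith
  -- Monotonicity with zeros at `a` and `b` forces a zero at the midpoint; Rolle on both halves then
  -- gives two distinct critical points.
  have hm0 : h ((a + b) / 2) = 0 :=
    le_antisymm (hb0 ▸ hmono hm2.le) (ha0 ▸ hmono hm1.le)
  obtain ⟨x, hx, hx0⟩ := exists_deriv_eq_zero hm1 hcont.continuousOn (ha0.trans hm0.symm)
  obtain ⟨y, hy, hy0⟩ := exists_deriv_eq_zero hm2 hcont.continuousOn (hm0.trans hb0.symm)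
  have : x = y := (hzero x hx0).trans (hzero y hy0).symm
  linarith [hx.2, hy.1]

lemma eq_of_scaled_two_cycle {l g x y : ℝ} (hl : 0 < l) (hg : 0 ≤ g) (hlg : l * g ≤ Real.exp 1)
    (hx : x = g * Real.exp (-(l * y))) (hy : y = g * Real.exp (-(l * x))) : x = y := by
  rcases hg.eq_or_lt with rfl | hg
  · rw [hx, hy]; simp
  · refine mul_left_cancel₀ hl.ne' (eq_of_two_cycle (mul_pos hl hg) hlg ?_ ?_)
    · rw [mul_assoc, ← hx]
    · rw [mul_assoc, ← hy]

/-! ### The Poisson case -/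

variable (lam : ℝ≥0)

/-- The generating function of the Poisson law at the mass of `B`. -/
lemma measureReal_forall_children {B : Set (List ℕ → ℕ)} (hB : MeasurableSet B) :
    (sizes (poissonMeasure lam)).real {c | ∀ i < c [], child c i ∈ B} =
      Real.exp (-(lam * (1 - (sizes (poissonMeasure lam)).real B))) := by
  set b := (sizes (poissonMeasure lam)).real B with hb
  have hb0 : 0 ≤ b := measureReal_nonneg
  have hsum : HasSum (fun n : ℕ => Real.exp (-lam) * lam ^ n / n.factorial * b ^ n)
      (Real.exp (-(lam * (1 - b)))) := by
    have h1 := (NormedSpace.expSeries_div_hasSum_exp ((lam : ℝ) * b)).mul_left (Real.exp (-lam))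
    rw [← Real.exp_eq_exp_ℝ, ← Real.exp_add] at h1
    have h2 : ∀ n : ℕ, Real.exp (-lam) * lam ^ n / n.factorial * b ^ n =
        Real.exp (-lam) * ((lam * b) ^ n / n.factorial) := fun n => by
      rw [mul_pow]
      ring
    have h3 : -((lam : ℝ) * (1 - b)) = -lam + lam * b := by ring
    simpa only [h2, h3] using h1
  rw [measureReal_def, sizes_forall_children _ hB]
  have : ∀ n : ℕ, poissonMeasure lam {n} * sizes (poissonMeasure lam) B ^ n =
      ENNReal.ofReal (Real.exp (-lam) * lam ^ n / n.factorial * b ^ n) := by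
    intro n
    rw [poissonMeasure_singleton, ENNReal.ofReal_mul (by positivity), ENNReal.ofReal_pow hb0, hb,
      ofReal_measureReal]
  simp_rw [this]
  rw [← ENNReal.ofReal_tsum_of_nonneg (fun n => by positivity) hsum.summable, hsum.tsum_eq,
    ENNReal.toReal_ofReal (Real.exp_pos _).le]

lemma measureReal_compl_hasChild {B : Set (List ℕ → ℕ)} (hB : MeasurableSet B) :
    (sizes (poissonMeasure lam)).real (hasChild B)ᶜ =
      Real.exp (-(lam * (sizes (poissonMeasure lam)).real B)) := by
  have : (hasChild B)ᶜ = {c | ∀ i < c [], child c i ∈ Bᶜ} := by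
    ext c
    simp [hasChild]
  rw [this, measureReal_forall_children lam hB.compl, probReal_compl_eq_one_sub hB]
  ring_nf

lemma hasChild_union (A B : Set (List ℕ → ℕ)) :
    hasChild (A ∪ B) = hasChild A ∪ hasChild B := by
  ext c
  simp only [hasChild, Set.mem_ofPred_eq, Set.mem_union, and_or_left, exists_or]

/-- Independence of the events that there are children in disjoint classes. -/
lemma measureReal_remaining_inter_compl_hasChild (k : ℕ) {B : Set (List ℕ → ℕ)}
    (hB : MeasurableSet B) (hd : ∀ j < k, Disjoint B (stage j)) :
    (sizes (poissonMeasure lam)).real (remaining k ∩ (hasChild B)ᶜ) =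
      (sizes (poissonMeasure lam)).real (remaining k) *
        Real.exp (-(lam * (sizes (poissonMeasure lam)).real B)) := by
  induction k generalizing B with
  | zero => simp [remaining, measureReal_compl_hasChild lam hB]
  | succ k ih =>
    set M := sizes (poissonMeasure lam)
    have hS := measurableSet_stage k
    have hkS : ∀ j < k, Disjoint (stage k) (stage j) := fun j hj =>
      Set.disjoint_left.2 fun c hc hc' => hj.ne (stage_unique hc' hc)
    -- Proved for every admissible `B`, so that `B = ∅` also yields the mass of `remaining (k + 1)`.
    have key : ∀ B : Set (List ℕ → ℕ), MeasurableSet B → (∀ j < k + 1, Disjoint B (stage j)) →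
        M.real (remaining (k + 1) ∩ (hasChild B)ᶜ) =
          M.real (remaining k) * (1 - Real.exp (-(lam * M.real (stage k)))) *
            Real.exp (-(lam * M.real B)) := by
      intro B hB hd
      have h1 := ih hB fun j hj => hd j (hj.trans k.lt_succ_self)
      -- Inclusion-exclusion: a child in `stage k` but none in `B` means none in `B`, without the
      -- case of none in `B ∪ stage k`.
      have h2 := ih (B := B ∪ stage k) (hB.union hS) fun j hj =>
        Set.disjoint_union_left.2 ⟨hd j (hj.trans k.lt_succ_self), hkS j hj⟩
      rw [measureReal_union (hd k k.lt_succ_self) hS] at h2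
      have hdiff : remaining (k + 1) ∩ (hasChild B)ᶜ =
          (remaining k ∩ (hasChild B)ᶜ) \ (remaining k ∩ (hasChild (B ∪ stage k))ᶜ) := by
        ext c
        simp only [hasChild_union, remaining, stage, Set.mem_inter_iff, Set.mem_compl_iff,
          Set.mem_sdiff, Set.mem_union]
        tauto
      rw [hdiff, measureReal_sdiff, h1, h2, mul_add, neg_add, Real.exp_add]
      · ring
      · refine Set.inter_subset_inter_right _ (Set.compl_subset_compl.2 (hasChild_mono ?_))
        exact Set.subset_union_left
      · exact (measurableSet_remaining k).inter (measurableSet_hasChild (hB.union hS)).compl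
    have h0 := key ∅ .empty (by simp)
    have he : hasChild (∅ : Set (List ℕ → ℕ)) = ∅ := by ext c; simp [hasChild]
    rw [he, Set.compl_empty, Set.inter_univ, measureReal_empty, mul_zero, neg_zero, Real.exp_zero,
      mul_one] at h0
    rw [key B hB hd, h0]

lemma disjoint_stage_of_subset {k j : ℕ} (hj : j < k) {B : Set (List ℕ → ℕ)}
    (hB : B ⊆ remaining k) : Disjoint B (stage j) :=
  Set.disjoint_left.2 fun _ hc hc' => notMem_stage_of_mem_remaining hj (hB hc) hc'

lemma measureReal_remaining_succ (k : ℕ) :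
    (sizes (poissonMeasure lam)).real (remaining (k + 1)) =
      (sizes (poissonMeasure lam)).real (remaining k) -
      (sizes (poissonMeasure lam)).real (remaining k) *
        Real.exp (-(lam * (sizes (poissonMeasure lam)).real (stage k))) := by
  have h := measureReal_remaining_inter_compl_hasChild lam k (measurableSet_stage k)
    (fun j hj => disjoint_stage_of_subset hj (pPos_subset _))
  have h2 := measureReal_inter_add_sdiff (μ := sizes (poissonMeasure lam)) (s := remaining k)
    (measurableSet_hasChild (measurableSet_stage k))
  rw [Set.sdiff_eq] at h2
  rw [← h, ← h2]
  exact (add_sub_cancel_right _ _).symm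

/-- Both nested classes lie in `remaining k`, so they miss the earlier stages and the product
formula applies to each. -/
lemma measureReal_pWithin_succ (k n : ℕ) :
    (sizes (poissonMeasure lam)).real (pWithin (remaining k) (n + 1)) =
      (sizes (poissonMeasure lam)).real (remaining k) *
        Real.exp (-(lam * ((sizes (poissonMeasure lam)).real (remaining k) *
          Real.exp (-(lam * (sizes (poissonMeasure lam)).real (pWithin (remaining k) n)))))) := by
  have hR := measurableSet_remaining k
  have hW := measurableSet_pWithin hR n
  rw [← measureReal_remaining_inter_compl_hasChild lam k hW
    (fun j hj => disjoint_stage_of_subset hj (pWithin_subset _ n)),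
    ← measureReal_remaining_inter_compl_hasChild lam k
      (hR.inter (measurableSet_hasChild hW).compl)
      (fun j hj => disjoint_stage_of_subset hj Set.inter_subset_left)]
  rfl

lemma tendsto_measureReal_iUnion {α : Type*} [MeasurableSpace α] (μ : Measure α)
    [IsFiniteMeasure μ] {s : ℕ → Set α} (hs : Monotone s) :
    Filter.Tendsto (fun n => μ.real (s n)) Filter.atTop (nhds (μ.real (⋃ n, s n))) :=
  (ENNReal.tendsto_toReal (measure_ne_top μ _)).comp (tendsto_measure_iUnion_atTop hs)

lemma measureReal_stage_eq_two_cycle (k : ℕ) :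
    (sizes (poissonMeasure lam)).real (stage k) =
      (sizes (poissonMeasure lam)).real (remaining k) *
        Real.exp (-(lam * ((sizes (poissonMeasure lam)).real (remaining k) *
          Real.exp (-(lam * (sizes (poissonMeasure lam)).real (stage k)))))) := by
  have h := tendsto_measureReal_iUnion (sizes (poissonMeasure lam)) (pWithin_mono (remaining k))
  refine tendsto_nhds_unique ((Filter.tendsto_add_atTop_iff_nat 1).2 h) ?_
  simp_rw [measureReal_pWithin_succ]
  refine Filter.Tendsto.comp (g := fun x : ℝ => (sizes (poissonMeasure lam)).real (remaining k) *
    Real.exp (-(lam * ((sizes (poissonMeasure lam)).real (remaining k) *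
          Real.exp (-(lam * x)))))) (Continuous.tendsto (by fun_prop) _) h

/-- For `lam ≤ e` there are no draws at any stage. -/
lemma measureReal_stage (hl : 0 < lam) (he : (lam : ℝ) ≤ Real.exp 1) (k : ℕ) :
    (sizes (poissonMeasure lam)).real (stage k) =
      (sizes (poissonMeasure lam)).real (remaining k) *
        Real.exp (-(lam * (sizes (poissonMeasure lam)).real (stage k))) := by
  -- The second point of the cycle is `r exp(-λ x)`, so its equation is `rfl`.
  refine eq_of_scaled_two_cycle (l := lam) (by exact_mod_cast hl)
    (measureReal_nonneg (μ := sizes (poissonMeasure lam)) (s := remaining k)) ?_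
    (measureReal_stage_eq_two_cycle lam k) rfl
  exact (mul_le_of_le_one_right lam.2 measureReal_le_one).trans he

lemma measureReal_remaining_eq_add (hl : 0 < lam) (he : (lam : ℝ) ≤ Real.exp 1) (k : ℕ) :
    (sizes (poissonMeasure lam)).real (remaining k) =
      (sizes (poissonMeasure lam)).real (stage k) +
        (sizes (poissonMeasure lam)).real (remaining (k + 1)) := by
  rw [measureReal_remaining_succ, ← measureReal_stage lam hl he]
  ring

lemma ae_mem_stage_or_mem_remaining_succ (hl : 0 < lam) (he : (lam : ℝ) ≤ Real.exp 1) (k : ℕ) :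
    ∀ᵐ c ∂sizes (poissonMeasure lam), c ∈ remaining k → c ∈ stage k ∪ remaining (k + 1) := by
  set M := sizes (poissonMeasure lam)
  have hd : Disjoint (stage k) (remaining (k + 1)) := Set.disjoint_left.2 fun c hc hc' =>
    notMem_stage_of_mem_remaining k.lt_succ_self hc' hc
  have hsub : stage k ∪ remaining (k + 1) ⊆ remaining k :=
    Set.union_subset (pPos_subset _) Set.inter_subset_left
  have h0 : M.real (remaining k \ (stage k ∪ remaining (k + 1))) = 0 := by
    rw [measureReal_sdiff hsub ((measurableSet_stage k).union (measurableSet_remaining _)),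
      measureReal_union hd (measurableSet_remaining _), ← measureReal_remaining_eq_add lam hl he,
      sub_self]
  rw [measureReal_eq_zero_iff] at h0
  rw [ae_iff]
  refine measure_mono_null (fun c hc => ?_) h0
  exact Classical.not_imp.1 hc

lemma ae_mem_iUnion_stage (hl : 0 < lam) (he : (lam : ℝ) ≤ Real.exp 1) :
    ∀ᵐ c ∂sizes (poissonMeasure lam), c ∈ ⋃ k, stage k := by
  filter_upwards [ae_all_iff.2 (ae_mem_stage_or_mem_remaining_succ lam hl he)] with c hc
  by_contra hcon
  have : ∀ k, c ∈ remaining k := by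
    intro k
    induction k with
    | zero => trivial
    | succ k ih => exact (hc k ih).resolve_left fun h => hcon (Set.mem_iUnion.2 ⟨k, h⟩)
  obtain ⟨k, hk⟩ := exists_notMem_remaining c
  exact hk (this k)

/-! ### Draws for large parameters -/

/-- The bound `x ≤ 1/λ` is preserved by the recursion: it gives `exp(-λ exp(-λ x)) ≤ exp(-λ/e) ≤
1/λ`, because `λ ≤ exp(λ/e)`. -/
lemma measureReal_pWithin_le (hl : 0 < lam) (n : ℕ) :
    (sizes (poissonMeasure lam)).real (pWithin (remaining 0) n) ≤ (lam : ℝ)⁻¹ := by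
  have hl' : (0 : ℝ) < lam := by exact_mod_cast hl
  induction n with
  | zero => simp [pWithin]
  | succ n ih =>
    rw [measureReal_pWithin_succ]
    simp only [remaining, probReal_univ, one_mul]
    have h1 : Real.exp (-1) ≤
        Real.exp (-(lam * (sizes (poissonMeasure lam)).real (pWithin Set.univ n))) := by
      refine Real.exp_le_exp.2 (neg_le_neg ?_)
      exact (mul_le_mul_of_nonneg_left ih hl'.le).trans_eq (mul_inv_cancel₀ hl'.ne')
    have h2 : (lam : ℝ) ≤ Real.exp (lam * Real.exp (-1)) := by
      have h3 := Real.add_one_le_exp (lam * Real.exp (-1) - 1)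
      rw [sub_add_cancel, Real.exp_sub, le_div_iff₀ (Real.exp_pos 1), mul_assoc, ← Real.exp_add]
        at h3
      simpa using h3
    calc Real.exp (-(lam * Real.exp (-(lam *
          (sizes (poissonMeasure lam)).real (pWithin Set.univ n)))))
        ≤ Real.exp (-(lam * Real.exp (-1))) := by gcongr
      _ = (Real.exp (lam * Real.exp (-1)))⁻¹ := Real.exp_neg _
      _ ≤ (lam : ℝ)⁻¹ := inv_anti₀ hl' h2

lemma measureReal_draw_pos (he : Real.exp 1 < lam) :
    0 < (sizes (poissonMeasure lam)).real ((stage 0)ᶜ ∩ (remaining 1)ᶜ) := by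
  have hl' : (0 : ℝ) < lam := (Real.exp_pos 1).trans he
  have hl : 0 < lam := by exact_mod_cast hl'
  set M := sizes (poissonMeasure lam)
  set x := M.real (stage 0) with hx
  have hle : x ≤ (lam : ℝ)⁻¹ :=
    le_of_tendsto' (tendsto_measureReal_iUnion M (pWithin_mono (remaining 0)))
      (measureReal_pWithin_le lam hl)
  have h1 : M.real (remaining 1) = 1 - Real.exp (-(lam * x)) := by
    simpa [remaining] using measureReal_remaining_succ lam 0
  have hd : Disjoint (stage 0) (remaining 1) := Set.disjoint_left.2 fun c hc hc' =>
    notMem_stage_of_mem_remaining Nat.zero_lt_one hc' hc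
  rw [← Set.compl_union, probReal_compl_eq_one_sub
    ((measurableSet_stage 0).union (measurableSet_remaining 1)),
    measureReal_union hd (measurableSet_remaining 1), h1]
  have h2 : lam * x ≤ 1 :=
    (mul_le_mul_of_nonneg_left hle hl'.le).trans_eq (mul_inv_cancel₀ hl'.ne')
  have h3 : Real.exp (-1) ≤ Real.exp (-(lam * x)) := by gcongr
  have h4 : (lam : ℝ)⁻¹ < Real.exp (-1) := by
    rw [Real.exp_neg]
    exact inv_strictAnti₀ (Real.exp_pos 1) he
  linarith

/-! ### Extinction -/

lemma measureReal_extinctBy_succ (n : ℕ) :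
    (sizes (poissonMeasure lam)).real (extinctBy (n + 1)) =
      Real.exp (-(lam * (1 - (sizes (poissonMeasure lam)).real (extinctBy n)))) := by
  rw [extinctBy, measureReal_compl_hasChild lam (measurableSet_extinctBy n).compl,
    probReal_compl_eq_one_sub (measurableSet_extinctBy n)]

lemma measureReal_infinite_pos_iff :
    0 < (sizes (poissonMeasure lam)).real (⋃ n, extinctBy n)ᶜ ↔ 1 < lam := by
  set M := sizes (poissonMeasure lam)
  have ht := tendsto_measureReal_iUnion M extinctBy_mono
  set q := M.real (⋃ n, extinctBy n) with hq
  rw [probReal_compl_eq_one_sub (.iUnion measurableSet_extinctBy), sub_pos, ← hq]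
  have hfix : q = Real.exp (-(lam * (1 - q))) := by
    refine tendsto_nhds_unique ((Filter.tendsto_add_atTop_iff_nat 1).2 ht) ?_
    simp_rw [M, measureReal_extinctBy_succ]
    exact Filter.Tendsto.comp (g := fun x : ℝ => Real.exp (-(lam * (1 - x))))
      (Continuous.tendsto (by fun_prop) _) ht
  constructor
  · intro h
    by_contra! hl
    have hl' : (lam : ℝ) ≤ 1 := by exact_mod_cast hl
    rcases lam.2.eq_or_lt with h0 | h0
    · have h0' : (lam : ℝ) = 0 := h0.symm
      rw [h0'] at hfix
      simp at hfix
      linarith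
    · have h0' : (0 : ℝ) < lam := h0
      -- If `q < 1` and `λ ≤ 1`, then `q > 1 - λ (1 - q) ≥ q`.
      have := Real.add_one_lt_exp (x := -(lam * (1 - q))) (by nlinarith)
      nlinarith
  · intro hl
    have hl' : (1 : ℝ) < lam := by exact_mod_cast hl
    -- The bound `1/λ < 1` is preserved, since `exp(-(λ - 1)) ≤ 1/λ`.
    have hle : ∀ n, M.real (extinctBy n) ≤ (lam : ℝ)⁻¹ := by
      intro n
      induction n with
      | zero => simp [extinctBy]
      | succ n ih =>
        rw [measureReal_extinctBy_succ]
        have h1 : (lam : ℝ) - 1 ≤ lam * (1 - M.real (extinctBy n)) := by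
          have := mul_le_mul_of_nonneg_left ih (by linarith : (0 : ℝ) ≤ lam)
          rw [mul_inv_cancel₀ (by linarith)] at this
          linarith
        calc Real.exp (-(lam * (1 - M.real (extinctBy n)))) ≤ Real.exp (-(lam - 1)) := by
              gcongr
          _ = (Real.exp (lam - 1))⁻¹ := Real.exp_neg _
          _ ≤ (lam : ℝ)⁻¹ := by
            refine inv_anti₀ (by linarith) ?_
            have := Real.add_one_le_exp ((lam : ℝ) - 1)
            linarith
    exact (le_of_tendsto' ht hle).trans_lt (inv_lt_one_of_one_lt₀ hl')

/-! ### The law of a random tree is determined by the finite sets it contains -/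

/-- The words that follow the letter `i` in the words of `F`. -/
noncomputable def tails (F : Finset (List ℕ)) (i : ℕ) : Finset (List ℕ) :=
  F.preimage (i :: ·) List.cons_injective.injOn

/-- A strict upper bound for the first letters of the words of `F`. -/
def width (F : Finset (List ℕ)) : ℕ :=
  F.sup fun w => match w with
    | [] => 0
    | i :: _ => i + 1

@[simp] lemma mem_tails {F : Finset (List ℕ)} {i : ℕ} {w : List ℕ} :
    w ∈ tails F i ↔ i :: w ∈ F := by simp [tails]

lemma lt_width {F : Finset (List ℕ)} {i : ℕ} {w : List ℕ} (h : i :: w ∈ F) : i < width F :=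
  Finset.le_sup (f := fun w : List ℕ => match w with
    | [] => 0
    | i :: _ => i + 1) h

lemma width_le_iff {F : Finset (List ℕ)} {n : ℕ} :
    width F ≤ n ↔ ∀ i w, i :: w ∈ F → i < n := by
  refine ⟨fun h i w hw => (lt_width hw).trans_le h, fun h => Finset.sup_le fun w hw => ?_⟩
  cases w with
  | nil => exact Nat.zero_le _
  | cons i w => exact h i w hw

lemma tails_eq_empty {F : Finset (List ℕ)} {i : ℕ} (hi : width F ≤ i) : tails F i = ∅ := by
  ext w
  simp only [mem_tails, Finset.notMem_empty, iff_false]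
  exact fun h => absurd (lt_width h) hi.not_gt

lemma measurableSet_finset_subset (F : Finset (List ℕ)) :
    MeasurableSet {t : Set (List ℕ) | ↑F ⊆ t} := by
  have : {t : Set (List ℕ) | ↑F ⊆ t} = ⋂ u ∈ F, {t | u ∈ t} := by
    ext t
    simp [Set.subset_def]
  rw [this]
  exact .biInter F.countable_toSet fun u _ => measurableSet_mem u

/-- Two finite measures on sets agree if they give the same mass to all events `F ⊆ t`. -/
lemma measure_set_ext {μ ν : Measure (Set (List ℕ))} [IsFiniteMeasure μ]
    (h : ∀ F : Finset (List ℕ), μ {t | ↑F ⊆ t} = ν {t | ↑F ⊆ t}) : μ = ν := by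
  classical
  refine ext_of_generate_finite (Set.range fun F : Finset (List ℕ) => {t : Set (List ℕ) | ↑F ⊆ t})
    ?_ ?_ ?_ ?_
  · refine le_antisymm ?_ ?_
    · suffices hid : ∀ m : MeasurableSpace (Set (List ℕ)),
          (∀ F : Finset (List ℕ), MeasurableSet[m] {t : Set (List ℕ) | ↑F ⊆ t}) →
            Set.instMeasurableSpace ≤ m from
        hid _ fun F => MeasurableSpace.measurableSet_generateFrom ⟨F, rfl⟩
      intro m hm
      have hid : @Measurable (Set (List ℕ)) (Set (List ℕ)) m Set.instMeasurableSpace fun t => t :=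
        (@measurable_set_iff (List ℕ) (Set (List ℕ)) m fun t => t).2 fun u => by
          refine (@measurableSet_setOfPred (Set (List ℕ)) m _).1 ?_
          simpa using hm {u}
      exact fun s hs => hid hs
    · refine MeasurableSpace.generateFrom_le ?_
      rintro _ ⟨F, rfl⟩
      exact measurableSet_finset_subset F
  · rintro _ ⟨F, rfl⟩ _ ⟨F', rfl⟩ -
    refine ⟨F ∪ F', ?_⟩
    ext t
    simp [Set.union_subset_iff]
  · rintro _ ⟨F, rfl⟩
    exact h F
  · simpa using h ∅

lemma subset_tree_iff {F : Finset (List ℕ)} {c : List ℕ → ℕ} :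
    ↑F ⊆ tree c ↔ width F ≤ c [] ∧ ∀ i < width F, ↑(tails F i) ⊆ tree (child c i) := by
  rw [width_le_iff]
  constructor
  · refine fun h => ⟨fun i w hw => (cons_mem_tree.1 (h hw)).1, fun i _ w hw => ?_⟩
    exact (cons_mem_tree.1 (h (mem_tails.1 hw))).2
  · rintro ⟨h1, h2⟩ (_ | ⟨i, w⟩) hw
    · exact nil_mem_tree c
    · exact cons_mem_tree.2 ⟨h1 i w hw, h2 i (lt_width hw) (mem_tails.2 hw)⟩

lemma sizes_subset_tree (p : Measure ℕ) [IsProbabilityMeasure p] (F : Finset (List ℕ)) :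
    sizes p {c | ↑F ⊆ tree c} = p (Set.Ici (width F)) *
      ∏ i ∈ Finset.range (width F), sizes p {c | ↑(tails F i) ⊆ tree c} := by
  refine Eq.trans ?_ (sizes_root_children p (A := Set.Ici (width F)) (width F)
    (fun i => measurable_tree (measurableSet_finset_subset (tails F i))))
  congr 1
  ext c
  exact subset_tree_iff

/-! ### Thinning of a Poisson number of children -/

/-- Poisson splitting: keeping each of a Poisson number of children with probability `q` makes the
kept and the removed numbers independent Poisson variables. -/
lemma poissonMeasure_add_mul_choose (lam : ℝ≥0) {P q : ℝ≥0} (h : P + q = 1) (a b : ℕ) :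
    poissonMeasure lam {a + b} * ((a + b).choose a * (q ^ a * P ^ b : ℝ≥0)) =
      poissonMeasure (lam * q) {a} * poissonMeasure (lam * P) {b} := by
  have h1 : (((a + b).choose a : ℕ) * (q ^ a * P ^ b : ℝ≥0) : ℝ≥0∞) =
      ENNReal.ofReal ((a + b).choose a * ((q : ℝ) ^ a * (P : ℝ) ^ b)) := by
    rw [ENNReal.ofReal_mul (by positivity), ENNReal.ofReal_natCast]
    congr 1
    rw [← NNReal.coe_pow, ← NNReal.coe_pow, ← NNReal.coe_mul, ENNReal.ofReal_coe_nnreal]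
  rw [h1, poissonMeasure_singleton, poissonMeasure_singleton, poissonMeasure_singleton,
    ← ENNReal.ofReal_mul (by positivity), ← ENNReal.ofReal_mul (by positivity)]
  congr 1
  have h2 : (P : ℝ) + q = 1 := by exact_mod_cast h
  have h3 : Real.exp (-lam) = Real.exp (-(lam * q)) * Real.exp (-(lam * P)) := by
    rw [← Real.exp_add, ← neg_add, ← mul_add, add_comm (q : ℝ), h2, mul_one]
  have h4 : (((a + b).choose a : ℕ) : ℝ) * (a.factorial * b.factorial) = (a + b).factorial := by
    rw [← mul_assoc]
    exact_mod_cast Nat.choose_symm_add (a := a) (b := b) ▸ Nat.add_choose_mul_factorial_mul_factorial a b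
  push_cast
  rw [h3, ← h4]
  have hc : (((a + b).choose a : ℕ) : ℝ) ≠ 0 := by
    exact_mod_cast (Nat.choose_pos (Nat.le_add_right a b)).ne'
  field_simp
  ring

lemma tsum_sum_antidiagonal_mul (f g : ℕ → ℝ≥0∞) :
    ∑' n, ∑ x ∈ Finset.HasAntidiagonal.antidiagonal n, f x.1 * g x.2 = (∑' n, f n) * ∑' n, g n := by
  have h1 : ∑' x : ℕ × ℕ, f x.1 * g x.2 = (∑' n, f n) * ∑' n, g n := by
    rw [ENNReal.tsum_prod (f := fun a b => f a * g b), ← ENNReal.tsum_mul_right]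
    exact tsum_congr fun a => ENNReal.tsum_mul_left
  rw [← h1, ← Finset.HasAntidiagonal.sigmaAntidiagonalEquivProd.tsum_eq, ENNReal.tsum_sigma']
  refine tsum_congr fun n => ?_
  rw [← Finset.tsum_subtype]
  rfl

/-- Here `A` is the set of kept children. Grouping by its size factorises the sum; `A.card < n`
becomes the condition that at least one child is removed. -/
lemma tsum_sum_powerset_poissonMeasure (lam : ℝ≥0) {P q : ℝ≥0} (h : P + q = 1) (m : ℕ) :
    ∑' n, ∑ A ∈ (Finset.range n).powerset, (if m ≤ A.card ∧ A.card < n then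
      poissonMeasure lam {n} * (q ^ A.card * P ^ (n - A.card) : ℝ≥0) else 0) =
    poissonMeasure (lam * q) (Set.Ici m) * poissonMeasure (lam * P) (Set.Ioi 0) := by
  have h1 : ∀ n, ∑ A ∈ (Finset.range n).powerset, (if m ≤ A.card ∧ A.card < n then
      poissonMeasure lam {n} * (q ^ A.card * P ^ (n - A.card) : ℝ≥0) else 0) =
      ∑ x ∈ Finset.HasAntidiagonal.antidiagonal n,
        (Set.Ici m).indicator (fun a => poissonMeasure (lam * q) {a}) x.1 *
        (Set.Ioi 0).indicator (fun b => poissonMeasure (lam * P) {b}) x.2 := by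
    intro n
    rw [Finset.sum_powerset_apply_card (fun k => if m ≤ k ∧ k < n then
      poissonMeasure lam {n} * (q ^ k * P ^ (n - k) : ℝ≥0) else 0) (x := Finset.range n),
      Finset.card_range, Finset.Nat.sum_antidiagonal_eq_sum_range_succ_mk]
    refine Finset.sum_congr rfl fun k hk => ?_
    have hkn : k ≤ n := Nat.lt_succ_iff.1 (Finset.mem_range.1 hk)
    obtain ⟨b, rfl⟩ := Nat.exists_eq_add_of_le hkn
    simp only [Set.indicator, Set.mem_Ici, Set.mem_Ioi, Nat.add_sub_cancel_left]
    by_cases hm : m ≤ k <;> by_cases hb : 0 < b <;> simp only [hm, hb, true_and, false_and,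
      if_true, if_false, smul_zero, mul_zero, zero_mul, lt_add_iff_pos_right]
    rw [← poissonMeasure_add_mul_choose lam h, nsmul_eq_mul]
    ring
  simp_rw [h1]
  rw [tsum_sum_antidiagonal_mul, Measure.tsum_indicator_apply_singleton _ _ .of_discrete,
    Measure.tsum_indicator_apply_singleton _ _ .of_discrete]

/-! ### The family sizes of the reduced tree -/

lemma setOf_mem_finite (A : Finset ℕ) : {j | j ∈ A}.Finite := A.finite_toSet

lemma exists_count_eq {A : Finset ℕ} {i : ℕ} (hi : i < A.card) :
    ∃ j ∈ A, Nat.count (· ∈ A) j = i := by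
  have hf : (Set.ofPred fun j => j ∈ A).Finite := setOf_mem_finite A
  have hi' : i < hf.toFinset.card := by
    convert hi
    ext j
    simp
  exact ⟨_, Nat.nth_mem_of_lt_card hf hi', Nat.count_nth_of_lt_card_finite hf hi'⟩

lemma count_lt_card {A : Finset ℕ} {j : ℕ} (hj : j ∈ A) : Nat.count (· ∈ A) j < A.card := by
  have hf : (Set.ofPred fun j => j ∈ A).Finite := setOf_mem_finite A
  have := Nat.count_lt_card hf hj
  convert this
  ext j
  simp

/-- Counting smaller members numbers `A` as `0, 1, 2, …`, which is the renumbering of siblings. -/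
lemma prod_count {M : Type*} [CommMonoid M] (A : Finset ℕ) (f : ℕ → M) :
    ∏ j ∈ A, f (Nat.count (· ∈ A) j) = ∏ i ∈ Finset.range A.card, f i :=
  Finset.prod_bij (fun j _ => Nat.count (· ∈ A) j)
    (fun _ hj => Finset.mem_range.2 (count_lt_card hj))
    (fun _ hj _ hk h => Nat.count_injective hj hk h)
    (fun _ hi => by
      obtain ⟨j, hj, h⟩ := exists_count_eq (Finset.mem_range.1 hi)
      exact ⟨j, hj, h⟩)
    (fun _ _ => rfl)

open Classical in
/-- The children among the first `n` that are not P-positions. -/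
noncomputable def nonPChildren (n : ℕ) (c : List ℕ → ℕ) : Finset ℕ :=
  {j ∈ Finset.range n | child c j ∉ stage 0}

lemma mem_nonPChildren {n : ℕ} {c : List ℕ → ℕ} {j : ℕ} :
    j ∈ nonPChildren n c ↔ j < n ∧ child c j ∉ stage 0 := by
  simp [nonPChildren]

lemma ncard_eq_count {c : List ℕ → ℕ} {n j : ℕ} (hj : j < n) :
    {j' | j' < j ∧ child c j' ∉ stage 0}.ncard = Nat.count (· ∈ nonPChildren n c) j := by
  rw [Nat.count_eq_card_filter_range, ← Set.ncard_coe_finset]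
  congr 1
  ext i
  simp only [Set.mem_ofPred_eq, Finset.coe_filter, Finset.mem_range, mem_nonPChildren]
  exact and_congr_right fun hi => by simp [hi.trans hj]

lemma cons_mem_reduced {c : List ℕ → ℕ} {i : ℕ} {w : List ℕ} :
    i :: w ∈ reduced c ↔ ∃ j ∈ nonPChildren (c []) c,
      Nat.count (· ∈ nonPChildren (c []) c) j = i ∧ w ∈ reduced (child c j) := by
  simp only [mem_nonPChildren]
  constructor
  · rintro ⟨j, hj, hP, hi, hw⟩
    exact ⟨j, ⟨hj, hP⟩, by rw [← ncard_eq_count hj, hi], hw⟩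
  · rintro ⟨j, ⟨hj, hP⟩, hi, hw⟩
    exact ⟨j, hj, hP, by rw [ncard_eq_count hj, hi], hw⟩

lemma subset_reduced_iff {F : Finset (List ℕ)} {c : List ℕ → ℕ} :
    ↑F ⊆ reduced c ↔ width F ≤ (nonPChildren (c []) c).card ∧
      ∀ j ∈ nonPChildren (c []) c,
        ↑(tails F (Nat.count (· ∈ nonPChildren (c []) c) j)) ⊆ reduced (child c j) := by
  rw [width_le_iff]
  constructor
  · refine fun h => ⟨fun i w hw => ?_, fun j hj w hw => ?_⟩
    · obtain ⟨j, hj, rfl, -⟩ := cons_mem_reduced.1 (h hw)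
      exact count_lt_card hj
    · obtain ⟨k, hk, hkj, hwk⟩ := cons_mem_reduced.1 (h (mem_tails.1 hw))
      rwa [Nat.count_injective hk hj hkj] at hwk
  · rintro ⟨h1, h2⟩ (_ | ⟨i, w⟩) hw
    · trivial
    · obtain ⟨j, hj, rfl⟩ := exists_count_eq (h1 i w hw)
      exact cons_mem_reduced.2 ⟨j, hj, rfl, h2 j hj (mem_tails.2 hw)⟩

lemma mem_remaining_one_iff {c : List ℕ → ℕ} :
    c ∈ remaining 1 ↔ (nonPChildren (c []) c).card < c [] := by
  classical
  have h1 := Finset.card_filter_le (Finset.range (c [])) fun j => child c j ∉ stage 0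
  have h2 := Finset.card_filter_eq_iff (s := Finset.range (c []))
    (p := fun j => child c j ∉ stage 0)
  rw [Finset.card_range] at h1 h2
  have h3 : (nonPChildren (c []) c).card ≠ c [] ↔ c ∈ hasChild (stage 0) := by
    rw [nonPChildren, Ne, h2]
    simp [hasChild]
  rw [remaining, remaining, Set.univ_inter]
  exact h3.symm.trans (lt_iff_le_and_ne.trans (and_iff_right h1)).symm

open Classical in
/-- The root has `n` children, those in `A` are not P-positions, and the reduced tree contains `F`,
provided that `A` is large enough. -/
def reducedCell (F : Finset (List ℕ)) (n : ℕ) (A : Finset ℕ) : Set (List ℕ → ℕ) :=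
  {c | c [] ∈ ({n} : Set ℕ) ∧ ∀ j < n, child c j ∈
    if j ∈ A then (stage 0)ᶜ ∩ {d | ↑(tails F (Nat.count (· ∈ A) j)) ⊆ reduced d} else stage 0}

lemma mem_reducedCell_iff {F : Finset (List ℕ)} {n : ℕ} {A : Finset ℕ} (hA : A ⊆ Finset.range n)
    {c : List ℕ → ℕ} : c ∈ reducedCell F n A ↔ c [] = n ∧ nonPChildren n c = A ∧
      ∀ j ∈ A, ↑(tails F (Nat.count (· ∈ A) j)) ⊆ reduced (child c j) := by
  simp only [reducedCell, Set.mem_ofPred_eq, Set.mem_singleton_iff]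
  refine and_congr_right fun _ => ?_
  constructor
  · intro h
    refine ⟨?_, fun j hj => ?_⟩
    · ext j
      rw [mem_nonPChildren]
      constructor
      · rintro ⟨hj, hP⟩
        by_contra hjA
        exact hP (by simpa [hjA] using h j hj)
      · intro hjA
        have hj := Finset.mem_range.1 (hA hjA)
        have := h j hj
        rw [if_pos hjA] at this
        exact ⟨hj, this.1⟩
    · have := h j (Finset.mem_range.1 (hA hj))
      rw [if_pos hj] at this
      exact this.2
  · rintro ⟨rfl, h⟩ j hj
    split_ifs with hjA
    · exact ⟨(mem_nonPChildren.1 hjA).2, h j hjA⟩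
    · by_contra hP
      exact hjA (mem_nonPChildren.2 ⟨hj, hP⟩)

lemma measurableSet_subset_reduced (F : Finset (List ℕ)) :
    MeasurableSet {c | ↑F ⊆ reduced c} :=
  measurable_reduced (measurableSet_finset_subset F)

lemma measurableSet_reducedCell_fiber (F : Finset (List ℕ)) (A : Finset ℕ) [DecidablePred (· ∈ A)]
    (j : ℕ) : MeasurableSet (if j ∈ A then
      (stage 0)ᶜ ∩ {d | ↑(tails F (Nat.count (· ∈ A) j)) ⊆ reduced d} else stage 0) := by
  split_ifs
  · exact (measurableSet_stage 0).compl.inter (measurableSet_subset_reduced _)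
  · exact measurableSet_stage 0

lemma measurableSet_reducedCell (F : Finset (List ℕ)) (n : ℕ) (A : Finset ℕ) :
    MeasurableSet (reducedCell F n A) :=
  measurableSet_root_children _ n (measurableSet_reducedCell_fiber F A)

lemma remaining_one_inter_subset_reduced (F : Finset (List ℕ)) :
    remaining 1 ∩ {c | ↑F ⊆ reduced c} = ⋃ n, ⋃ A ∈ (Finset.range n).powerset,
      if width F ≤ A.card ∧ A.card < n then reducedCell F n A else ∅ := by
  ext c
  simp only [Set.mem_inter_iff, Set.mem_iUnion, Finset.mem_powerset, exists_prop]
  rw [mem_remaining_one_iff, Set.mem_ofPred_eq, subset_reduced_iff]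
  have hsub : ∀ n, nonPChildren n c ⊆ Finset.range n := fun n j hj =>
    Finset.mem_range.2 (mem_nonPChildren.1 hj).1
  constructor
  · rintro ⟨h1, h2, h3⟩
    refine ⟨c [], nonPChildren (c []) c, hsub _, ?_⟩
    rw [if_pos ⟨h2, h1⟩, mem_reducedCell_iff (hsub _)]
    exact ⟨rfl, rfl, h3⟩
  · rintro ⟨n, A, hA, h⟩
    split_ifs at h with hc
    · obtain ⟨rfl, rfl, h3⟩ := (mem_reducedCell_iff hA).1 h
      exact ⟨hc.2, hc.1, h3⟩
    · exact h.elim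

lemma sizes_remaining_one_inter (p : Measure ℕ) [IsProbabilityMeasure p] (F : Finset (List ℕ)) :
    sizes p (remaining 1 ∩ {c | ↑F ⊆ reduced c}) = ∑' n, ∑ A ∈ (Finset.range n).powerset,
      if width F ≤ A.card ∧ A.card < n then p {n} *
        ((∏ i ∈ Finset.range A.card, sizes p ((stage 0)ᶜ ∩ {d | ↑(tails F i) ⊆ reduced d})) *
          sizes p (stage 0) ^ (n - A.card)) else 0 := by
  classical
  have hmeas : ∀ n A, MeasurableSet
      (if width F ≤ Finset.card A ∧ A.card < n then reducedCell F n A else ∅) := by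
    intro n A
    split_ifs
    · exact measurableSet_reducedCell F n A
    · exact .empty
  rw [remaining_one_inter_subset_reduced, measure_iUnion]
  · refine tsum_congr fun n => ?_
    rw [measure_biUnion_finset]
    · refine Finset.sum_congr rfl fun A hA => ?_
      rw [Finset.mem_powerset] at hA
      split_ifs with hc
      · rw [reducedCell, sizes_root_children p n (measurableSet_reducedCell_fiber F A)]
        congr 1
        rw [← Finset.prod_sdiff hA, mul_comm]
        congr 1
        · rw [← prod_count A fun i => sizes p ((stage 0)ᶜ ∩ {d | ↑(tails F i) ⊆ reduced d})]
          exact Finset.prod_congr rfl fun j hj => by rw [if_pos hj]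
        · rw [Finset.prod_congr rfl (g := fun _ => sizes p (stage 0)) fun j hj => by
            rw [if_neg (Finset.mem_sdiff.1 hj).2], Finset.prod_const, Finset.card_sdiff_of_subset hA,
            Finset.card_range]
      · exact measure_empty
    · intro A hA A' hA' hne
      refine Set.disjoint_left.2 fun c hc hc' => hne ?_
      dsimp only at hc hc'
      split_ifs at hc hc' with h1 h2
      · rw [mem_reducedCell_iff (Finset.mem_powerset.1 hA)] at hc
        rw [mem_reducedCell_iff (Finset.mem_powerset.1 hA')] at hc'
        exact hc.2.1.symm.trans hc'.2.1
      all_goals first | exact hc.elim | exact hc'.elim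
    · exact fun A _ => hmeas n A
  · intro n n' hne
    refine Set.disjoint_left.2 fun c hc hc' => hne ?_
    have key : ∀ n, c ∈ (⋃ A ∈ (Finset.range n).powerset,
        if width F ≤ A.card ∧ A.card < n then reducedCell F n A else ∅) → c [] = n := by
      intro n hc
      simp only [Set.mem_iUnion, Finset.mem_powerset, exists_prop] at hc
      obtain ⟨A, hA, hc⟩ := hc
      split_ifs at hc
      · exact ((mem_reducedCell_iff hA).1 hc).1
      · exact hc.elim
    exact (key n hc).symm.trans (key n' hc')
  · exact fun n => .biUnion (Finset.countable_toSet _) fun A _ => hmeas n A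

/-- Without draws a kept child is an N-position, in the same situation as the conditioned root; this
closes the recursion. -/
lemma sizes_compl_stage_inter {lam : ℝ≥0} (hl : 0 < lam) (he : (lam : ℝ) ≤ Real.exp 1)
    (X : Set (List ℕ → ℕ)) :
    sizes (poissonMeasure lam) ((stage 0)ᶜ ∩ X) = sizes (poissonMeasure lam) (remaining 1 ∩ X) := by
  refine measure_congr ?_
  filter_upwards [ae_mem_stage_or_mem_remaining_succ lam hl he 0] with c hc
  have h1 : c ∈ stage 0 ∪ remaining 1 := hc trivial
  have h2 : c ∈ remaining 1 → c ∉ stage 0 := notMem_stage_of_mem_remaining Nat.zero_lt_one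
  have h3 : c ∈ (stage 0)ᶜ ↔ c ∈ remaining 1 := ⟨fun h => h1.resolve_left h, h2⟩
  exact propext (and_congr_left' h3)

lemma coe_eq_exp_neg {lam P : ℝ≥0} (hl : 0 < lam) (he : (lam : ℝ) ≤ Real.exp 1)
    (hP : sizes (poissonMeasure lam) (stage 0) = P) : (P : ℝ) = Real.exp (-(lam * P)) := by
  have h := measureReal_stage lam hl he 0
  simp only [measureReal_def, hP, ENNReal.coe_toReal, remaining, measure_univ, ENNReal.toReal_one,
    one_mul] at h
  exact h

/-- The fixed point equation makes `1 - exp(-λ P)`, the chance of a P-child, equal to `1 - P`. -/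
lemma poissonMeasure_Ioi_zero {lam P : ℝ≥0} (h : (P : ℝ) = Real.exp (-(lam * P))) :
    poissonMeasure (lam * P) (Set.Ioi 0) = (1 - P : ℝ≥0) := by
  have h1 : (Set.Ioi 0 : Set ℕ) = {0}ᶜ := by
    ext n
    simp [Nat.pos_iff_ne_zero]
  rw [h1, prob_compl_eq_one_sub (measurableSet_singleton 0), poissonMeasure_singleton]
  simp only [NNReal.coe_mul, pow_zero, mul_one, Nat.factorial_zero, Nat.cast_one, div_one, ← h,
    ENNReal.ofReal_coe_nnreal, ENNReal.coe_sub, ENNReal.coe_one]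

lemma sizes_remaining_one {lam P : ℝ≥0} (hl : 0 < lam) (he : (lam : ℝ) ≤ Real.exp 1)
    (hP : sizes (poissonMeasure lam) (stage 0) = P) :
    sizes (poissonMeasure lam) (remaining 1) = (1 - P : ℝ≥0) := by
  have h := sizes_compl_stage_inter hl he Set.univ
  rw [Set.inter_univ, Set.inter_univ, prob_compl_eq_one_sub (measurableSet_stage 0), hP] at h
  simp [← h]

/-- On the event that the root is an N-position, the reduced tree has the law of a Galton-Watson
tree with a thinned offspring distribution. -/
theorem sizes_remaining_one_inter_eq {lam P : ℝ≥0} (hl : 0 < lam) (he : (lam : ℝ) ≤ Real.exp 1)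
    (hP : sizes (poissonMeasure lam) (stage 0) = P) (F : Finset (List ℕ)) :
    sizes (poissonMeasure lam) (remaining 1 ∩ {c | ↑F ⊆ reduced c}) =
      (1 - P : ℝ≥0) * sizes (poissonMeasure (lam * (1 - P))) {c | ↑F ⊆ tree c} := by
  have hP1 : P ≤ 1 := by
    rw [← ENNReal.coe_le_coe, ← hP]
    exact prob_le_one
  have hfix := coe_eq_exp_neg hl he hP
  set q := 1 - P with hq
  have hPq : P + q = 1 := add_tsub_cancel_of_le hP1
  obtain ⟨N, hN⟩ : ∃ N, ∀ w ∈ F, w.length < N :=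
    ⟨F.sup List.length + 1, fun w hw => Nat.lt_succ_of_le (Finset.le_sup (f := List.length) hw)⟩
  -- The induction is on a bound for the lengths of the words, which drops on passing to `tails`.
  induction N generalizing F with
  | zero =>
    obtain rfl : F = ∅ := Finset.eq_empty_of_forall_notMem fun w hw => Nat.not_lt_zero _ (hN w hw)
    simp [sizes_remaining_one hl he hP, hq]
  | succ N ih =>
    have ih' : ∀ i, sizes (poissonMeasure lam) ((stage 0)ᶜ ∩ {d | ↑(tails F i) ⊆ reduced d}) =
        q * sizes (poissonMeasure (lam * q)) {c | ↑(tails F i) ⊆ tree c} := fun i => by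
      rw [sizes_compl_stage_inter hl he]
      refine ih _ fun w hw => ?_
      simpa using hN _ (mem_tails.1 hw)
    rw [sizes_remaining_one_inter, sizes_subset_tree]
    set C := ∏ i ∈ Finset.range (width F), sizes (poissonMeasure (lam * q))
      {c | ↑(tails F i) ⊆ tree c} with hC
    -- Beyond `width F` the tails are empty and contribute factors `1`, so the product does not
    -- depend on the number of kept children.
    have hCA : ∀ n, width F ≤ n → ∏ i ∈ Finset.range n, sizes (poissonMeasure (lam * q))
        {c | ↑(tails F i) ⊆ tree c} = C := by
      intro n hn
      refine (Finset.prod_subset (Finset.range_mono hn) fun i _ hi => ?_).symm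
      rw [tails_eq_empty (not_lt.1 fun h => hi (Finset.mem_range.2 h))]
      simp
    have hterm : ∀ n : ℕ, ∀ A : Finset ℕ, (if width F ≤ A.card ∧ A.card < n then
        poissonMeasure lam {n} * ((∏ i ∈ Finset.range A.card, sizes (poissonMeasure lam)
          ((stage 0)ᶜ ∩ {d | ↑(tails F i) ⊆ reduced d})) *
            sizes (poissonMeasure lam) (stage 0) ^ (n - A.card)) else 0) =
        (if width F ≤ A.card ∧ A.card < n then
          poissonMeasure lam {n} * (q ^ A.card * P ^ (n - A.card) : ℝ≥0) else 0) * C := by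
      intro n A
      split_ifs with h
      · simp_rw [ih']
        rw [Finset.prod_mul_distrib, hCA _ h.1, Finset.prod_const, Finset.card_range, hP]
        push_cast
        ring
      · rw [zero_mul]
    simp_rw [hterm, ← Finset.sum_mul]
    rw [ENNReal.tsum_mul_right, tsum_sum_powerset_poissonMeasure lam hPq,
      poissonMeasure_Ioi_zero hfix, ← hq]
    ring

/-! ### Random trees with the law of a Galton-Watson tree -/

section transfer

variable {Ω : Type*} [MeasurableSpace Ω] {μ : Measure Ω} {p : Measure ℕ}
  {T : Ω → Set (List ℕ)}

instance (p : Measure ℕ) [IsProbabilityMeasure p] : IsProbabilityMeasure (law p) :=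
  Measure.isProbabilityMeasure_map measurable_tree.aemeasurable

lemma law_subset (p : Measure ℕ) [IsProbabilityMeasure p] (F : Finset (List ℕ)) :
    law p {t | ↑F ⊆ t} = sizes p {c | ↑F ⊆ tree c} :=
  Measure.map_apply measurable_tree (measurableSet_finset_subset F)

lemma measure_familySize_mem (hT : HasLaw T (law p) μ) {B : Set (List ℕ → ℕ)}
    (hB : MeasurableSet B) (hinv : TreeInvariant B) :
    μ {ω | familySize (T ω) ∈ B} = sizes p B := by
  have h1 : μ {ω | familySize (T ω) ∈ B} = law p {t | familySize t ∈ B} :=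
    hT.measure_eq (measurable_familySize hB)
  refine h1.trans ((Measure.map_apply measurable_tree (measurable_familySize hB)).trans ?_)
  congr 1
  ext c
  exact hinv.mem_iff (tree_familySize_tree c)

/-- `T` has values in arbitrary sets of words and is a tree only almost surely. -/
lemma ae_tree_familySize (hT : HasLaw T (law p) μ) : ∀ᵐ ω ∂μ, tree (familySize (T ω)) = T ω := by
  have hm : MeasurableSet {t : Set (List ℕ) | tree (familySize t) = t} := by
    simp_rw [Set.ext_iff]
    refine measurableSet_setOfPred.2 (.forall fun u => .iff ?_ (measurable_set_mem u))
    exact (measurable_set_mem u).comp (measurable_tree.comp measurable_familySize)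
  have h : ∀ᵐ t ∂law p, tree (familySize t) = t := by
    rw [law, ae_map_iff measurable_tree.aemeasurable hm]
    exact ae_of_all _ tree_familySize_tree
  rw [← hT.map_eq] at h
  exact ae_of_ae_map hT.aemeasurable h

lemma ae_familySize_mem (hT : HasLaw T (law p) μ) {B : Set (List ℕ → ℕ)}
    (hB : MeasurableSet B) (hinv : TreeInvariant B) (h : ∀ᵐ c ∂sizes p, c ∈ B) :
    ∀ᵐ ω ∂μ, familySize (T ω) ∈ B := by
  have h1 : sizes p Bᶜ = 0 := h
  rw [← measure_familySize_mem hT hB.compl hinv.compl] at h1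
  exact h1

lemma measure_setOf_eq (hT : HasLaw T (law p) μ) {Q : Set (List ℕ) → Prop}
    {B : Set (List ℕ → ℕ)} (hQ : ∀ c, Q (tree c) ↔ c ∈ B) :
    {ω | Q (T ω)} =ᵐ[μ] {ω | familySize (T ω) ∈ B} := by
  filter_upwards [ae_tree_familySize hT] with ω hω
  have := hQ (familySize (T ω))
  rw [hω] at this
  exact propext this

lemma measure_of_tree_iff (hT : HasLaw T (law p) μ) {Q : Set (List ℕ) → Prop}
    {B : Set (List ℕ → ℕ)} (hQ : ∀ c, Q (tree c) ↔ c ∈ B) (hB : MeasurableSet B) :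
    μ {ω | Q (T ω)} = sizes p B := by
  rw [measure_congr (measure_setOf_eq hT hQ), measure_familySize_mem hT hB]
  exact fun c c' h hc => (hQ c').1 (h ▸ (hQ c).2 hc)

end transfer

lemma measurableSet_forall_descend {B : Set (List ℕ → ℕ)} (hB : MeasurableSet B) :
    MeasurableSet {c | ∀ u ∈ tree c, descend c u ∈ B} := by
  have : {c | ∀ u ∈ tree c, descend c u ∈ B} =
      ⋂ u, {c | u ∈ tree c}ᶜ ∪ (fun c => descend c u) ⁻¹' B := by
    ext c
    simp [imp_iff_not_or]
  rw [this]
  exact .iInter fun u =>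
    (measurable_tree (measurableSet_mem u)).compl.union (measurable_descend u hB)

section poisson

variable {Ω : Type*} [MeasurableSpace Ω] {μ : Measure Ω} {lam : ℝ≥0} {T : Ω → Set (List ℕ)}

lemma ae_forall_stage (hT : HasLaw T (law (poissonMeasure lam)) μ) (hl : 0 < lam)
    (he : (lam : ℝ) ≤ Real.exp 1) : ∀ᵐ ω ∂μ, ∃ c, tree c = T ω ∧
      ∀ u ∈ tree c, descend c u ∈ ⋃ k, stage k := by
  have h := ae_familySize_mem hT (measurableSet_forall_descend (.iUnion measurableSet_stage))
    (TreeInvariant.iUnion treeInvariant_stage).forall_descend (by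
      filter_upwards [ae_forall_descend _ (ae_mem_iUnion_stage lam hl he)] with c hc u _
      exact hc u)
  filter_upwards [h, ae_tree_familySize hT] with ω h1 h2
  exact ⟨_, h2, h1⟩

lemma ae_drawFree (hT : HasLaw T (law (poissonMeasure lam)) μ) (hl : 0 < lam)
    (he : (lam : ℝ) ≤ Real.exp 1) : ∀ᵐ ω ∂μ, (graph (T ω)).DrawFree := by
  filter_upwards [ae_forall_stage hT hl he] with ω ⟨c, hc, h⟩
  rw [← hc]
  exact drawFree_of_forall_stage h

lemma ae_rank_ne_top (hT : HasLaw T (law (poissonMeasure lam)) μ) (hl : 0 < lam)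
    (he : (lam : ℝ) ≤ Real.exp 1) : ∀ᵐ ω ∂μ, ∀ x : T ω, (graph (T ω)).rank x ≠ ⊤ := by
  filter_upwards [ae_forall_stage hT hl he] with ω ⟨c, hc, h⟩
  rw [← hc]
  exact rank_ne_top_of_forall_stage h

lemma measure_rootD_pos (hT : HasLaw T (law (poissonMeasure lam)) μ) (he : Real.exp 1 < lam) :
    0 < μ {ω | RootD (T ω)} := by
  rw [measure_of_tree_iff hT rootD_iff
    ((measurableSet_stage 0).compl.inter (measurableSet_remaining 1).compl)]
  exact (ENNReal.toReal_pos_iff.1 (measureReal_draw_pos lam he)).1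

lemma measure_infinite_pos_iff (hT : HasLaw T (law (poissonMeasure lam)) μ) :
    0 < μ {ω | (T ω).Infinite} ↔ 1 < lam := by
  rw [measure_of_tree_iff hT infinite_tree_iff (.compl (.iUnion measurableSet_extinctBy)),
    ← measureReal_infinite_pos_iff, measureReal_def, ENNReal.toReal_pos_iff]
  exact ⟨fun h => ⟨h, measure_lt_top _ _⟩, fun h => h.1⟩

lemma sizes_stage_zero (hT : HasLaw T (law (poissonMeasure lam)) μ) :
    sizes (poissonMeasure lam) (stage 0) = (μ {ω | RootP (T ω)}).toNNReal := by
  rw [measure_of_tree_iff hT rootP_iff (measurableSet_stage 0), ENNReal.coe_toNNReal]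
  exact measure_ne_top _ _

lemma mul_one_sub_lt (hl : 0 < lam) (he : (lam : ℝ) ≤ Real.exp 1) {P : ℝ≥0}
    (hP : sizes (poissonMeasure lam) (stage 0) = P) : lam * (1 - P) < lam := by
  have h0 : 0 < P := by
    rw [← NNReal.coe_pos, coe_eq_exp_neg hl he hP]
    exact Real.exp_pos _
  exact mul_lt_of_lt_one_right hl (tsub_lt_self one_pos h0)

lemma one_sub_pos (hl : 0 < lam) (he : (lam : ℝ) ≤ Real.exp 1) {P : ℝ≥0}
    (hP : sizes (poissonMeasure lam) (stage 0) = P) : 0 < 1 - P := by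
  have h := coe_eq_exp_neg hl he hP
  have h0 : (0 : ℝ) < P := h ▸ Real.exp_pos _
  rw [tsub_pos_iff_lt, ← NNReal.coe_lt_coe, h, NNReal.coe_one, Real.exp_lt_one_iff]
  exact neg_lt_zero.2 (mul_pos (NNReal.coe_pos.2 hl) h0)

theorem hasLaw_reducedTree (hT : HasLaw T (law (poissonMeasure lam)) μ) (hl : 0 < lam)
    (he : (lam : ℝ) ≤ Real.exp 1) {P : ℝ≥0} (hP : sizes (poissonMeasure lam) (stage 0) = P) :
    HasLaw (fun ω => reducedTree (T ω)) (law (poissonMeasure (lam * (1 - P))))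
      (cond μ {ω | RootN (T ω)}) := by
  have hX : AEMeasurable (fun ω => familySize (T ω)) μ :=
    measurable_familySize.comp_aemeasurable hT.aemeasurable
  have hN := measure_setOf_eq hT rootN_iff
  -- The event is described by the family sizes only up to a null set, and `T` is only almost
  -- everywhere measurable.
  have hnull : NullMeasurableSet {ω | RootN (T ω)} μ :=
    (hX.nullMeasurable (measurableSet_remaining 1)).congr hN.symm
  have hae : (fun ω => reducedTree (T ω)) =ᵐ[cond μ {ω | RootN (T ω)}]
      fun ω => reduced (familySize (T ω)) := by
    filter_upwards [ae_cond_mem₀ hnull, cond_absolutelyContinuous.ae_le (ae_tree_familySize hT)]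
      with ω h1 h2
    have h1' : RootN (T ω) := h1
    rw [← h2, rootN_iff] at h1'
    conv_lhs => rw [← h2]
    exact reducedTree_tree (notMem_stage_of_mem_remaining Nat.zero_lt_one h1')
  have hmeas : AEMeasurable (fun ω => reduced (familySize (T ω))) (cond μ {ω | RootN (T ω)}) :=
    (measurable_reduced.comp_aemeasurable hX).mono_ac cond_absolutelyContinuous
  have hμN : μ {ω | RootN (T ω)} = (1 - P : ℝ≥0) := by
    rw [measure_of_tree_iff hT rootN_iff (measurableSet_remaining 1), sizes_remaining_one hl he hP]
  have : IsProbabilityMeasure μ := hT.isProbabilityMeasure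
  refine ⟨hmeas.congr hae.symm, ?_⟩
  rw [Measure.map_congr hae]
  refine measure_set_ext fun F => ?_
  have hF := measurableSet_subset_reduced F
  have hinv : TreeInvariant (remaining 1 ∩ {c | ↑F ⊆ reduced c}) :=
    (treeInvariant_remaining 1).inter fun c c' h hc w hw =>
      treeInvariant_reducedMem w c c' h (hc hw)
  rw [Measure.map_apply_of_aemeasurable hmeas (measurableSet_finset_subset F), law_subset,
    ProbabilityTheory.cond,
    Measure.smul_apply, Measure.restrict_congr_set hN, hμN]
  rw [Measure.restrict_apply₀' (s := {ω | familySize (T ω) ∈ remaining 1}) (hX.nullMeasurable (measurableSet_remaining 1))]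
  have hset : (fun ω => reduced (familySize (T ω))) ⁻¹' {t | ↑F ⊆ t} ∩
      {ω | familySize (T ω) ∈ remaining 1} =
      {ω | familySize (T ω) ∈ remaining 1 ∩ {c | ↑F ⊆ reduced c}} := by
    ext ω
    exact and_comm
  rw [hset, measure_familySize_mem hT ((measurableSet_remaining 1).inter hF) hinv,
    sizes_remaining_one_inter_eq hl he hP, smul_eq_mul, ← mul_assoc, ENNReal.inv_mul_cancel,
    one_mul]
  · exact ENNReal.coe_ne_zero.2 (one_sub_pos hl he hP).ne'
  · exact ENNReal.coe_ne_top

end poisson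

end GW

/-! ### Assembly -/

theorem mainTheorem9 {Ω : Type*} [MeasurableSpace Ω] (μ : Measure Ω)
    (lam : ℝ≥0) (hlam : 0 < lam) (T : Ω → Set (List ℕ))
    (hT : HasLaw T (GW.law (poissonMeasure lam)) μ) :
    -- the tree is infinite with positive probability iff `lam > 1`
    (0 < μ {ω | (T ω).Infinite} ↔ 1 < lam) ∧
    -- for `lam > e` the game is a draw with positive probability
    (Real.exp 1 < lam → 0 < μ {ω | GW.RootD (T ω)}) ∧
    ((lam : ℝ) ≤ Real.exp 1 →
      -- there are no draws
      (∀ᵐ ω ∂μ, (GW.graph (T ω)).DrawFree) ∧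
      -- given that the root is an N-position, the reduced tree is a Poisson Galton-Watson tree
      -- with the smaller parameter `lam * (1 - P)`, and it is again draw-free
      (∀ P : ℝ≥0, P = (μ {ω | GW.RootP (T ω)}).toNNReal →
        lam * (1 - P) < lam ∧
        HasLaw (fun ω => GW.reducedTree (T ω)) (GW.law (poissonMeasure (lam * (1 - P))))
          (cond μ {ω | GW.RootN (T ω)})) ∧
      (∀ᵐ ω ∂(cond μ {ω | GW.RootN (T ω)}), (GW.graph (GW.reducedTree (T ω))).DrawFree) ∧
      -- all positions have finite rank
      (∀ᵐ ω ∂μ, ∀ x : T ω, (GW.graph (T ω)).rank x ≠ ⊤)) ∧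
    -- there is no phase with infinite-rank positions but no draws
    ¬ ((∀ᵐ ω ∂μ, (GW.graph (T ω)).DrawFree) ∧
      0 < μ {ω | ∃ x : T ω, (GW.graph (T ω)).rank x = ⊤}) := by
  refine ⟨GW.measure_infinite_pos_iff hT, GW.measure_rootD_pos hT, fun he => ?_, ?_⟩
  · have hP := GW.sizes_stage_zero hT
    refine ⟨GW.ae_drawFree hT hlam he, ?_, ?_, GW.ae_rank_ne_top hT hlam he⟩
    · rintro P rfl
      exact ⟨GW.mul_one_sub_lt hlam he hP, GW.hasLaw_reducedTree hT hlam he hP⟩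
    -- The reduced tree is a Poisson tree whose parameter is positive, because `P < 1`, and still at
    -- most `e`.
    · refine GW.ae_drawFree (GW.hasLaw_reducedTree hT hlam he hP)
        (mul_pos hlam (GW.one_sub_pos hlam he hP)) ?_
      exact (NNReal.coe_le_coe.2 (GW.mul_one_sub_lt hlam he hP).le).trans he
  · rintro ⟨hdraw, hrank⟩
    -- Up to `e` all ranks are finite; beyond `e` the root is a draw with positive probability.
    rcases le_or_gt (lam : ℝ) (Real.exp 1) with he | he
    · refine hrank.ne' (measure_mono_null (fun ω hω => ?_)
        (ae_iff.1 (GW.ae_rank_ne_top hT hlam he)))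
      obtain ⟨x, hx⟩ := hω
      exact fun h => h x hx
    · refine (GW.measure_rootD_pos hT he).ne' (measure_mono_null (fun ω hω => ?_) (ae_iff.1 hdraw))
      obtain ⟨h, hD⟩ := hω
      exact fun hfree => hfree _ hD
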